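/- **Theorem (first-order optimality conditions, finite-dimensional problem).** Let $d,m,N\ge 1$, $T>0$, let $\mathcal U\subset\mathbb R^{md}$ be nonempty and compact, and let $H,G^1,\dots,G^d:\mathbb R^d\to\mathbb R^d$ be differentiable, locally Lipschitz and of at most linear growth, i.e. $|F(z)|\le C_F(1+|z|)$ for $F=H,G^1,\dots,G^d$. Let $L:\mathbb R^{dm}\times\mathbb R^{dN}\to\mathbb R$ be differentiable and locally Lipschitz, and let $\bar Y_0\in\mathbb R^{dm}$, $\bar X_0\in\mathbb R^{dN}$. For $y\in\mathbb R^{dm}$, $x\in\mathbb R^{dN}$, $\mathbf u\in\mathbb R^{md}$ put $$f_i(y,x,\mathbf u)=\frac1N\sum_{j=1}^N H(x_i-x_j)+\sum_{\ell=1}^d\frac1m\sum_{k=1}^m u_{k\ell}\,G^\ell(x_i-y_k),\qquad i=1,\dots,N .$$ Consider the problem of minimizing $$\int_0^T\Big(L(Y(t),X(t))+\sum_{k=1}^m|\mathbf u_k(t)|^2\Big)dt$$ over all $\mathbf u\in L^\infty([0,T],\mathcal U)$ and $(Y,X)\in H^1([0,T],\mathbb R^{dm})\times H^1([0,T],\mathbb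 R^{dN})$ with $$\dot Y_k=\mathbf u_k,\qquad \dot X_i=f_i(Y,X,\mathbf u),\qquad Y(0)=\bar Y_0,\quad X(0)=\bar X_0 .$$ Let $(\bar Y,\bar X,\bar{\mathbf u})$ be an optimal solution. Then there are adjoint states $(\xi_Y,\xi_X)\in L^2([0,T],\mathbb R^{dm})\times L^2([0,T],\mathbb R^{dN})$, belonging to $H^1$, which together with $(\bar Y,\bar X,\bar{\mathbf u})$ satisfy, for almost every $t\in[0,T]$, the state equations above with their initial conditions, the backward adjoint system $$-\dot\xi_{Y_k}=\nabla_{Y_k}L(\bar Y,\bar X)+\sum_{j=1}^N \xi_{X_j}\cdot\partial_{Y_k}f_j(\bar Y,\bar X,\bar{\mathbf u}),\qquad -\dot\xi_{X_i}=\nabla_{X_i}L(\bar Y,\bar X)+\sum_{j=1}^N \xi_{X_j}\cdot\partial_{X_i}f_j(\bar Y,\bar X,\bar{\mathbf u})$$ with the terminal conditions $\xi_Y(T)=0$, $\xi_X(T)=0$, and the projection formula $$\bar{\mathbf u}(t)\in\mathrm{Proj}_{\mathcal U}(p(t)),\qquad p_{k\ell}(t)=-\frac12\Big(\frac1m\sum_{i=1}^N\xi_{X_i}(t)\cdot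 G^\ell\big(\bar X_i(t)-\bar Y_k(t)\big)+\xi_{Y_k}^\ell(t)\Big).$$ Here $\xi\cdot\partial f$ denotes the transpose of the Jacobian matrix $\partial f$ applied to $\xi$, and $\mathrm{Proj}_{\mathcal U}(p)$ is the set of points of $\mathcal U$ nearest to $p$ in the Euclidean norm of $\mathbb R^{md}$ (a single point if $\mathcal U$ is convex). In particular, for $L(Y,X)=\frac12\sum_{i=1}^N|X_i-X^*|^2$ with $X^*\in\mathbb R^d$, the adjoint system reads $$-\dot\xi_{Y_k}=\sum_{j}\xi_{X_j}\cdot\partial_{Y_k}f_j(\bar Y,\bar X,\bar{\mathbf u}),\qquad -\dot\xi_{X_i}=\bar X_i-X^*+\sum_{j}\xi_{X_j}\cdot\partial_{X_i}f_j(\bar Y,\bar X,\bar{\mathbf u}) .$$ -/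

import Mathlib

open MeasureTheory Set

noncomputable section

namespace LeaderFollower

/-- The physical space `ℝ^d` with its Euclidean norm. -/
abbrev Pt (d : ℕ) : Type := EuclideanSpace ℝ (Fin d)

/-- The control space `ℝ^{md}` with its Euclidean norm: `u k ℓ` is the `ℓ`-th component of the
velocity of the `k`-th leader. -/
abbrev Ctrl (d m : ℕ) : Type := PiLp 2 (fun _ : Fin m => Pt d)

/-- The data of the optimal control problem with `m` leaders and `N` followers in `ℝ^d`:
horizon `T`, interaction kernels `H` and `G ℓ`, running cost `L (y, x)`, control set `U`, and the
initial positions of leaders and followers. -/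
structure Problem (d m N : ℕ) where
  T : ℝ
  H : Pt d → Pt d
  G : Fin d → Pt d → Pt d
  L : (Fin m → Pt d) × (Fin N → Pt d) → ℝ
  U : Set (Ctrl d m)
  Y₀ : Fin m → Pt d
  X₀ : Fin N → Pt d

/-- Assumptions on an interaction kernel: locally Lipschitz, at most linear growth, and
differentiable. -/
structure IsKernel {d : ℕ} (F : Pt d → Pt d) : Prop where
  locallyLipschitz : LocallyLipschitz F
  growth : ∃ C : ℝ, ∀ z, ‖F z‖ ≤ C * (1 + ‖z‖)
  differentiable : Differentiable ℝ F

/-- `x` belongs to `H¹([0,T], E)` (through its absolutely continuous representative) and has weak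
derivative `v`: `v ∈ L²(0,T)` and `x t = x 0 + ∫₀ᵗ v` on `[0,T]`. This is how an equation
`ẋ = v` for almost every time in `[0,T]` (in the sense of Carathéodory) is expressed. -/
def HasWeakDerivOn {E : Type*} [NormedAddCommGroup E] [NormedSpace ℝ E]
    (T : ℝ) (x v : ℝ → E) : Prop :=
  MemLp v 2 (volume.restrict (Icc 0 T)) ∧ ∀ t ∈ Icc 0 T, x t = x 0 + ∫ s in (0 : ℝ)..t, v s

/-- `u` is a metric projection of `p` onto `U`, i.e. a point of `U` nearest to `p` (the unique one
when `U` is closed and convex). -/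
def IsProj {E : Type*} [PseudoMetricSpace E] (U : Set E) (p u : E) : Prop :=
  u ∈ U ∧ dist p u = Metric.infDist p U

/-- The cost `½ ∑ᵢ |xᵢ - Xs|²` of the distance of the followers from a desired position `Xs`. -/
def trackingCost {d m N : ℕ} (Xs : Pt d) (z : (Fin m → Pt d) × (Fin N → Pt d)) : ℝ :=
  (1 / 2) * ∑ i, ‖z.2 i - Xs‖ ^ 2

namespace Problem

variable {d m N : ℕ} (P : Problem d m N)

/-- The velocity `(H * μ_N)(xᵢ) + ∑_ℓ (G^ℓ * μ_{m,ℓ})(xᵢ)` of the `i`-th follower, where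
`μ_N = (1/N) ∑ⱼ δ_{xⱼ}` and `μ_{m,ℓ} = (1/m) ∑ₖ u_{kℓ} δ_{yₖ}`. -/
def velocity (y : Fin m → Pt d) (x : Fin N → Pt d) (u : Ctrl d m) (i : Fin N) : Pt d :=
  (1 / (N : ℝ)) • ∑ j, P.H (x i - x j)
    + ∑ ℓ, (1 / (m : ℝ)) • ∑ k, u k ℓ • P.G ℓ (x i - y k)

/-- Admissible controls: measurable `u` on `[0,T]` with values in `U` almost everywhere (when `U`
is bounded these are the elements of `L^∞([0,T], U)`). -/
def IsControl (u : ℝ → Ctrl d m) : Prop :=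
  AEStronglyMeasurable u (volume.restrict (Icc 0 P.T)) ∧
    ∀ᵐ t ∂(volume.restrict (Icc 0 P.T)), u t ∈ P.U

/-- The controlled state equation with its initial condition. -/
structure StateEq (Y : ℝ → Fin m → Pt d) (X : ℝ → Fin N → Pt d) (u : ℝ → Ctrl d m) : Prop where
  leaders : ∀ k, HasWeakDerivOn P.T (fun t => Y t k) (fun t => u t k)
  followers : ∀ i, HasWeakDerivOn P.T (fun t => X t i) (fun t => P.velocity (Y t) (X t) (u t) i)
  init_leaders : Y 0 = P.Y₀
  init_followers : X 0 = P.X₀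

/-- The cost functional. -/
def cost (Y : ℝ → Fin m → Pt d) (X : ℝ → Fin N → Pt d) (u : ℝ → Ctrl d m) : ℝ :=
  ∫ t in (0 : ℝ)..P.T, (P.L (Y t, X t) + ∑ k, ‖u t k‖ ^ 2)

/-- `(Y, X, u)` is an optimal solution: it is admissible and no admissible triple costs less. -/
structure IsOptimal (Y : ℝ → Fin m → Pt d) (X : ℝ → Fin N → Pt d) (u : ℝ → Ctrl d m) : Prop where
  control : P.IsControl u
  state : P.StateEq Y X u
  minimal : ∀ Y' X' u', P.IsControl u' → P.StateEq Y' X' u' → P.cost Y X u ≤ P.cost Y' X' u'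

/-- `∑ⱼ ξⱼ · ∂_{y_k} (velocity of follower j)`, a vector of `ℝ^d`. -/
def adjY (y : Fin m → Pt d) (x : Fin N → Pt d) (u : Ctrl d m) (ξ : Fin N → Pt d) (k : Fin m) :
    Pt d :=
  ∑ j, ContinuousLinearMap.adjoint
    (fderiv ℝ (fun z => P.velocity (Function.update y k z) x u j) (y k)) (ξ j)

/-- `∑ⱼ ξⱼ · ∂_{x_i} (velocity of follower j)`, a vector of `ℝ^d`; the dependence on `x_i` through
the empirical measure `μ_N` is included. -/
def adjX (y : Fin m → Pt d) (x : Fin N → Pt d) (u : Ctrl d m) (ξ : Fin N → Pt d) (i : Fin N) :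
    Pt d :=
  ∑ j, ContinuousLinearMap.adjoint
    (fderiv ℝ (fun z => P.velocity y (Function.update x i z) u j) (x i)) (ξ j)

/-- The partial gradient of the running cost in the position of the `k`-th leader. -/
def gradY (y : Fin m → Pt d) (x : Fin N → Pt d) (k : Fin m) : Pt d :=
  gradient (fun z => P.L (Function.update y k z, x)) (y k)

/-- The partial gradient of the running cost in the position of the `i`-th follower. -/
def gradX (y : Fin m → Pt d) (x : Fin N → Pt d) (i : Fin N) : Pt d :=
  gradient (fun z => P.L (y, Function.update x i z)) (x i)

/-- The point of `ℝ^{md}` with components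
`-½ ((1/m) ∑ᵢ ξ_{Xᵢ} · G^ℓ(xᵢ - yₖ) + ξ_{Yₖ}^ℓ)`. -/
def feedback (y : Fin m → Pt d) (x : Fin N → Pt d) (ξY : Fin m → Pt d) (ξX : Fin N → Pt d) :
    Ctrl d m :=
  WithLp.toLp 2 fun k => WithLp.toLp 2 fun ℓ =>
    -(1 / 2) * ((1 / (m : ℝ)) * ∑ i, inner ℝ (ξX i) (P.G ℓ (x i - y k)) + ξY k ℓ)

/-- The first order optimality system for `(Y, X, u)` with adjoint states `(ξY, ξX)`. -/
structure FirstOrder (Y : ℝ → Fin m → Pt d) (X : ℝ → Fin N → Pt d) (u : ℝ → Ctrl d m)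
    (ξY : ℝ → Fin m → Pt d) (ξX : ℝ → Fin N → Pt d) : Prop where
  memY : MemLp ξY 2 (volume.restrict (Icc 0 P.T))
  memX : MemLp ξX 2 (volume.restrict (Icc 0 P.T))
  control : ∀ᵐ t ∂(volume.restrict (Icc 0 P.T)),
    IsProj P.U (P.feedback (Y t) (X t) (ξY t) (ξX t)) (u t)
  state : P.StateEq Y X u
  adjointY : ∀ k, HasWeakDerivOn P.T (fun t => ξY t k)
    (fun t => -(P.gradY (Y t) (X t) k + P.adjY (Y t) (X t) (u t) (ξX t) k))
  adjointX : ∀ i, HasWeakDerivOn P.T (fun t => ξX t i)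
    (fun t => -(P.gradX (Y t) (X t) i + P.adjX (Y t) (X t) (u t) (ξX t) i))
  terminalY : ξY P.T = 0
  terminalX : ξX P.T = 0

end Problem

end LeaderFollower

end

open Filter Topology

noncomputable section

/-! Write z = (Y, X) and the state equations as ż = f(u, z). The result is Pontryagin's principle
for this system, proved by needle variations, followed by completing a square in the control.

Let ξ be the curve of linear functionals with -ξ' = L'(z) + ξ ∘ ∂f/∂z and ξ(T) = 0. Replace the
optimal u by a constant v ∈ U on a small measurable set B. The trajectory then moves by some δ with
sup|δ| = O(|B|) (`IsControlProcess.exists_perturbation`). Pairing ξ with δ and integrating by parts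
(`integral_duality`) cancels every term linear in δ, so the cost changes by at most the integral
over B of the Hamiltonian increment from u to v, plus errors that are o(|B|)
(`IsControlProcess.cost_sub_le`). If this increment were negative on a non-null set, shrinking B
inside a level set {increment ≤ -c} would lower the optimal cost. Hence for each v it is nonnegative
almost everywhere, and a countable dense subset of U gives all v at once
(`IsControlProcess.exists_adjoint`).

The derivatives of f and L need not be continuous, so the Taylor remainder is o(|B|) only for each
fixed time. The local Lipschitz bounds dominate it by a multiple of |B|, and dominated convergence
does the rest. Since B is any measurable set, no Lebesgue points are needed.

Finally f is affine in the control, so the Hamiltonian is |v|² - 2⟨p, v⟩ + const = |v - p|² + const,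
and its minimizers over U are the points of U nearest to p. -/

/-! ### Integral equations, duality, and small sets of positive measure. -/

theorem intervalIntegral_exp_mul {c t : ℝ} (hc : c ≠ 0) :
    ∫ s in (0 : ℝ)..t, Real.exp (c * s) = (Real.exp (c * t) - 1) / c := by
  rw [intervalIntegral.integral_comp_mul_left (fun x => Real.exp x) hc, integral_exp]
  simp [div_eq_inv_mul]

theorem norm_intervalIntegral_le_setIntegral_Icc {E : Type*} [NormedAddCommGroup E]
    [NormedSpace ℝ E] {T t : ℝ} {f : ℝ → E} (hf : IntegrableOn f (Icc 0 T)) (ht : t ∈ Icc 0 T) :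
    ‖∫ s in (0 : ℝ)..t, f s‖ ≤ ∫ s in Icc 0 T, ‖f s‖ := by
  refine (intervalIntegral.norm_integral_le_integral_norm ht.1).trans ?_
  rw [intervalIntegral.integral_of_le ht.1]
  exact setIntegral_mono_set hf.norm (ae_of_all _ fun _ => norm_nonneg _)
    (Ioc_subset_Icc_self.trans (Icc_subset_Icc_right ht.2)).eventuallyLE

theorem MeasureTheory.IntegrableOn.intervalIntegrable_of_mem_Icc {E : Type*} [NormedAddCommGroup E]
    {T s t : ℝ} {f : ℝ → E} (hf : IntegrableOn f (Icc 0 T)) (hs : s ∈ Icc 0 T)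
    (ht : t ∈ Icc 0 T) : IntervalIntegrable f volume s t :=
  (hf.mono_set (uIcc_subset_Icc hs ht)).intervalIntegrable

/-- Carathéodory's version of the Picard–Lindelöf theorem in a tube around zero. -/
theorem exists_integral_solution {E : Type*} [NormedAddCommGroup E] [NormedSpace ℝ E]
    [CompleteSpace E] {T K a ρ : ℝ} (hT : 0 ≤ T) (hK : 0 < K) {g : ℝ → E → E}
    (hmeas : ∀ w : ℝ → E, Continuous w →
      AEStronglyMeasurable (fun t => g t (w t)) (volume.restrict (Icc 0 T)))
    (hlip : ∀ᵐ t ∂(volume.restrict (Icc 0 T)), ∀ x y : E, ‖x‖ ≤ ρ → ‖y‖ ≤ ρ →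
      ‖g t x - g t y‖ ≤ K * ‖x - y‖)
    (hint : IntegrableOn (fun t => g t 0) (Icc 0 T))
    (ha : ∫ t in Icc 0 T, ‖g t 0‖ ≤ a)
    (hρ : 2 * a * Real.exp (2 * K * T) ≤ ρ) :
    ∃ w : ℝ → E, Continuous w ∧ (∀ t ∈ Icc 0 T, ‖w t‖ ≤ 2 * a * Real.exp (2 * K * T)) ∧
      IntegrableOn (fun t => g t (w t)) (Icc 0 T) ∧
      ∀ t ∈ Icc 0 T, w t = ∫ s in (0 : ℝ)..t, g s (w s) := by
  have ha0 : 0 ≤ a := (integral_nonneg fun _ => norm_nonneg _).trans ha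
  -- The fixed point is sought for η = e^(-2Kt) w instead of w. This exponential weight makes the
  -- integral operator a contraction on all of [0, T], so no gluing of short intervals is needed.
  set lift : C(Icc (0 : ℝ) T, E) → ℝ → E :=
    fun η s => Real.exp (2 * K * s) • IccExtend hT η s with hlift
  have lift_cont : ∀ η, Continuous (lift η) := fun η => by
    have : Continuous (IccExtend hT η) := η.continuous.Icc_extend'
    fun_prop
  have lift_norm : ∀ η s, ‖lift η s‖ ≤ Real.exp (2 * K * s) * ‖η‖ := fun η s => by
    rw [hlift, norm_smul, Real.norm_of_nonneg (Real.exp_pos _).le]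
    gcongr
    exact η.norm_coe_le_norm _
  have lift_sub : ∀ η η' s, lift η s - lift η' s = lift (η - η') s := fun η η' s => by
    simp [hlift, IccExtend, smul_sub]
  have exp_le : ∀ s ∈ Icc 0 T, Real.exp (2 * K * s) ≤ Real.exp (2 * K * T) := fun s hs =>
    Real.exp_le_exp.2 (by have := hs.2; gcongr)
  have lift_le : ∀ η : C(Icc (0 : ℝ) T, E), ‖η‖ ≤ 2 * a → ∀ s ∈ Icc 0 T,
      ‖lift η s‖ ≤ 2 * a * Real.exp (2 * K * T) := fun η hη s hs => by
    refine (lift_norm η s).trans ?_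
    rw [mul_comm (2 * a)]
    exact mul_le_mul (exp_le s hs) hη (norm_nonneg _) (Real.exp_pos _).le
  have hlip' : ∀ η η' : C(Icc (0 : ℝ) T, E), ‖η‖ ≤ 2 * a → ‖η'‖ ≤ 2 * a →
      ∀ᵐ t ∂(volume.restrict (Icc 0 T)),
        ‖g t (lift η t) - g t (lift η' t)‖ ≤ K * (Real.exp (2 * K * t) * ‖η - η'‖) := by
    intro η η' hη hη'
    filter_upwards [hlip, ae_restrict_mem measurableSet_Icc] with t ht hmem
    refine (ht _ _ ((lift_le η hη t hmem).trans hρ) ((lift_le η' hη' t hmem).trans hρ)).trans ?_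
    rw [lift_sub]
    gcongr
    exact lift_norm _ _
  have lift_zero : ∀ s, lift 0 s = 0 := fun s => by simp [hlift, IccExtend]
  have hI : ∀ η : C(Icc (0 : ℝ) T, E), ‖η‖ ≤ 2 * a →
      IntegrableOn (fun t => g t (lift η t)) (Icc 0 T) := by
    intro η hη
    have h1 : IntegrableOn (fun t => g t (lift η t) - g t 0) (Icc 0 T) := by
      refine Integrable.of_bound ((hmeas _ (lift_cont η)).sub hint.aestronglyMeasurable)
        (K * (Real.exp (2 * K * T) * ‖η‖)) ?_
      filter_upwards [hlip' η 0 hη (by simpa using ha0), ae_restrict_mem measurableSet_Icc]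
        with t ht hmem
      rw [lift_zero, sub_zero] at ht
      refine ht.trans ?_
      have := exp_le t hmem
      gcongr
    have := h1.add hint
    refine this.congr (ae_of_all _ fun t => ?_)
    simp
  -- Integrating K e^(2Ks) over [0, t] gives (e^(2Kt) - 1)/2: this is the contraction factor 1/2.
  have key : ∀ η η' : C(Icc (0 : ℝ) T, E), ‖η‖ ≤ 2 * a → ‖η'‖ ≤ 2 * a → ∀ t ∈ Icc 0 T,
      ‖(∫ s in (0 : ℝ)..t, g s (lift η s)) - ∫ s in (0 : ℝ)..t, g s (lift η' s)‖
        ≤ Real.exp (2 * K * t) * (‖η - η'‖ / 2) := by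
    intro η η' hη hη' t ht
    have h0 : (0 : ℝ) ∈ Icc 0 T := ⟨le_rfl, hT⟩
    rw [← intervalIntegral.integral_sub ((hI η hη).intervalIntegrable_of_mem_Icc h0 ht)
      ((hI η' hη').intervalIntegrable_of_mem_Icc h0 ht)]
    have hb : ∀ᵐ s ∂volume, s ∈ Ioc 0 t →
        ‖g s (lift η s) - g s (lift η' s)‖ ≤ K * (Real.exp (2 * K * s) * ‖η - η'‖) := by
      have := (ae_restrict_iff' measurableSet_Icc).1 (hlip' η η' hη hη')
      filter_upwards [this] with s hs hst
      exact hs ⟨hst.1.le, hst.2.trans ht.2⟩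
    refine (intervalIntegral.norm_integral_le_of_norm_le ht.1 hb
      (Continuous.intervalIntegrable (by fun_prop) _ _)).trans ?_
    rw [intervalIntegral.integral_const_mul, intervalIntegral.integral_mul_const,
      intervalIntegral_exp_mul (by positivity)]
    have : K * ((Real.exp (2 * K * t) - 1) / (2 * K) * ‖η - η'‖)
        = (Real.exp (2 * K * t) - 1) * (‖η - η'‖ / 2) := by field_simp
    rw [this]
    gcongr
    linarith
  have hcont : ∀ η : C(Icc (0 : ℝ) T, E), ‖η‖ ≤ 2 * a →
      ContinuousOn (fun t => ∫ s in (0 : ℝ)..t, g s (lift η s)) (Icc 0 T) := by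
    intro η hη
    have := intervalIntegral.continuousOn_primitive_interval (μ := volume)
      (f := fun s => g s (lift η s)) (a := 0) (b := T) (by rw [uIcc_of_le hT]; exact hI η hη)
    rwa [uIcc_of_le hT] at this
  let Φ : {η : C(Icc (0 : ℝ) T, E) // ‖η‖ ≤ 2 * a} → C(Icc (0 : ℝ) T, E) := fun η =>
    ⟨fun t => Real.exp (-(2 * K * t)) • ∫ s in (0 : ℝ)..t, g s (lift η s), by
      have := (hcont η η.2).domRestrict
      have h2 : Continuous fun t : Icc (0 : ℝ) T => ∫ s in (0 : ℝ)..t, g s (lift η s) := this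
      fun_prop⟩
  have exp_cancel : ∀ t c : ℝ, Real.exp (-(2 * K * t)) * (Real.exp (2 * K * t) * c) = c :=
    fun t c => by rw [← mul_assoc, ← Real.exp_add]; simp
  have hΦlip : ∀ η η', ‖Φ η - Φ η'‖ ≤ ‖η.1 - η'.1‖ / 2 := by
    intro η η'
    refine (ContinuousMap.norm_le _ (by positivity)).2 fun t => ?_
    change ‖Real.exp (-(2 * K * t)) • (∫ s in (0 : ℝ)..t, g s (lift η s))
      - Real.exp (-(2 * K * t)) • ∫ s in (0 : ℝ)..t, g s (lift η' s)‖ ≤ _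
    rw [← smul_sub, norm_smul, Real.norm_of_nonneg (Real.exp_pos _).le,
      ← exp_cancel t (‖η.1 - η'.1‖ / 2)]
    gcongr
    exact key _ _ η.2 η'.2 t t.2
  let zero : {η : C(Icc (0 : ℝ) T, E) // ‖η‖ ≤ 2 * a} := ⟨0, by simpa using ha0⟩
  have hΦzero : ‖Φ zero‖ ≤ a := by
    refine (ContinuousMap.norm_le _ ha0).2 fun t => ?_
    change ‖Real.exp (-(2 * K * t)) • ∫ s in (0 : ℝ)..t, g s (lift 0 s)‖ ≤ _
    simp only [lift_zero]
    rw [norm_smul, Real.norm_of_nonneg (Real.exp_pos _).le]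
    refine (mul_le_of_le_one_left (norm_nonneg _) ?_).trans
      ((norm_intervalIntegral_le_setIntegral_Icc hint t.2).trans ha)
    have := t.2.1
    exact Real.exp_le_one_iff.2 (neg_nonpos.2 (by positivity))
  -- The radius 2a reproduces itself: the image of zero has norm at most a, and the contraction adds
  -- at most half of 2a.
  have hΦmem : ∀ η, ‖Φ η‖ ≤ 2 * a := by
    intro η
    have h1 := hΦlip η zero
    have h2 : ‖η.1 - zero.1‖ ≤ 2 * a := by simpa [zero] using η.2
    have h3 : ‖Φ η‖ ≤ ‖Φ η - Φ zero‖ + ‖Φ zero‖ := by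
      simpa using norm_add_le (Φ η - Φ zero) (Φ zero)
    linarith
  let Ψ : {η : C(Icc (0 : ℝ) T, E) // ‖η‖ ≤ 2 * a} → {η : C(Icc (0 : ℝ) T, E) // ‖η‖ ≤ 2 * a} :=
    fun η => ⟨Φ η, hΦmem η⟩
  have hΨ : ContractingWith (1 / 2) Ψ := by
    refine ⟨by norm_num, LipschitzWith.of_dist_le_mul fun η η' => ?_⟩
    rw [Subtype.dist_eq, Subtype.dist_eq, dist_eq_norm, dist_eq_norm]
    refine (hΦlip η η').trans (le_of_eq ?_)
    push_cast
    ring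
  have : CompleteSpace {η : C(Icc (0 : ℝ) T, E) // ‖η‖ ≤ 2 * a} := by
    have : IsClosed {η : C(Icc (0 : ℝ) T, E) | ‖η‖ ≤ 2 * a} :=
      isClosed_le continuous_norm continuous_const
    exact this.completeSpace_coe
  have : Nonempty {η : C(Icc (0 : ℝ) T, E) // ‖η‖ ≤ 2 * a} := ⟨zero⟩
  obtain ⟨η, hη⟩ : ∃ η, Ψ η = η := ⟨_, hΨ.fixedPoint_isFixedPt⟩
  refine ⟨lift η, lift_cont _, lift_le _ η.2, hI _ η.2, fun t ht => ?_⟩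
  have h1 : Φ η ⟨t, ht⟩ = η.1 ⟨t, ht⟩ := by rw [← congrArg Subtype.val hη]
  have h2 : Φ η ⟨t, ht⟩
      = Real.exp (-(2 * K * t)) • ∫ s in (0 : ℝ)..t, g s (lift η s) := rfl
  have h3 : lift η t = Real.exp (2 * K * t) • η.1 ⟨t, ht⟩ := by
    simp only [hlift, IccExtend_of_mem hT _ ht]
  rw [h3, ← h1, h2, smul_smul, ← Real.exp_add]
  simp

/-- Integration by parts for absolutely continuous curves in duality, one vanishing at the
final and the other at the initial time. -/
theorem integral_duality {E : Type*} [NormedAddCommGroup E] [NormedSpace ℝ E]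
    [CompleteSpace E] {T : ℝ} {p : ℝ → E →L[ℝ] ℝ} {v : ℝ → E}
    (hp : IntegrableOn p (Icc 0 T)) (hv : IntegrableOn v (Icc 0 T)) :
    ∫ s in Icc 0 T, (∫ t in s..T, p t) (v s) = ∫ t in Icc 0 T, p t (∫ s in (0 : ℝ)..t, v s) := by
  simp only [IntegrableOn, ← restrict_Ioc_eq_restrict_Icc] at hp hv ⊢
  set μ := volume.restrict (Ioc 0 T) with hμ
  have hmeas : MeasurableSet {z : ℝ × ℝ | z.1 ≤ z.2} := measurableSet_le measurable_fst measurable_snd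
  have hint : Integrable (fun z : ℝ × ℝ => p z.2 (v z.1)) (μ.prod μ) := by
    refine (hv.norm.mul_prod hp.norm).mono' ?_ (ae_of_all _ fun z => ?_)
    · exact isBoundedBilinearMap_apply.continuous.comp_aestronglyMeasurable
        (hp.aestronglyMeasurable.comp_snd.prodMk hv.aestronglyMeasurable.comp_fst)
    · rw [mul_comm]
      exact (p z.2).le_opNorm _
  -- Both sides are the integral of p t (v s) over the triangle s ≤ t, taken in the two orders, so
  -- Fubini identifies them.
  have hint' := hint.indicator hmeas
  have hswap := integral_integral_swap (f := fun s t => {z : ℝ × ℝ | z.1 ≤ z.2}.indicator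
    (fun z : ℝ × ℝ => p z.2 (v z.1)) (s, t)) hint'
  refine Eq.trans ?_ (hswap.trans ?_)
  · refine setIntegral_congr_fun measurableSet_Ioc fun s hs => ?_
    have h1 : (fun t => {z : ℝ × ℝ | z.1 ≤ z.2}.indicator (fun z : ℝ × ℝ => p z.2 (v z.1)) (s, t))
        = (Ici s).indicator (fun t => p t (v s)) := by
      ext t
      simp [indicator]
    have h2 : Ioc 0 T ∩ Ici s = Icc s T := by
      ext t
      simp only [mem_inter_iff, mem_Ioc, mem_Ici, mem_Icc]
      exact ⟨fun h => ⟨h.2, h.1.2⟩, fun h => ⟨⟨hs.1.trans_le h.1, h.2⟩, h.1⟩⟩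
    have h3 : Integrable p (volume.restrict (Ioc s T)) :=
      IntegrableOn.mono_set hp (Ioc_subset_Ioc_left hs.1.le)
    simp only [h1, hμ]
    rw [setIntegral_indicator measurableSet_Ici, h2, integral_Icc_eq_integral_Ioc,
      intervalIntegral.integral_of_le hs.2, ContinuousLinearMap.integral_apply h3]
  · refine setIntegral_congr_fun measurableSet_Ioc fun t ht => ?_
    have h1 : (fun s => {z : ℝ × ℝ | z.1 ≤ z.2}.indicator (fun z : ℝ × ℝ => p z.2 (v z.1)) (s, t))
        = (Iic t).indicator (fun s => p t (v s)) := by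
      ext s
      simp [indicator]
    have h2 : Ioc 0 T ∩ Iic t = Ioc 0 t := by
      rw [Ioc_inter_Iic, min_eq_right ht.2]
    have h3 : Integrable v (volume.restrict (Ioc 0 t)) :=
      IntegrableOn.mono_set hv (Ioc_subset_Ioc_right ht.2)
    simp only [h1, hμ]
    rw [setIntegral_indicator measurableSet_Iic, h2, intervalIntegral.integral_of_le ht.1.le,
      ContinuousLinearMap.integral_comp_comm _ h3]

/-- Countably many half-open intervals of length ε cover the line. If A met each of them in a null
set, A would be null. -/
theorem exists_measurable_subset_volume_le {A : Set ℝ} (hA : MeasurableSet A)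
    (hA0 : volume A ≠ 0) {ε : ℝ} (hε : 0 < ε) :
    ∃ B ⊆ A, MeasurableSet B ∧ volume B ≠ 0 ∧ volume B ≤ ENNReal.ofReal ε := by
  by_contra! h
  refine hA0 ?_
  rw [← inter_univ A, ← iUnion_Ioc_zsmul hε, inter_iUnion, measure_iUnion_null_iff]
  intro n
  by_contra hn
  refine (h _ inter_subset_left (hA.inter measurableSet_Ioc) hn).not_ge
    ((measure_mono inter_subset_right).trans ?_)
  rw [Real.volume_Ioc]
  refine ENNReal.ofReal_le_ofReal (le_of_eq ?_)
  simp only [zsmul_eq_mul]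
  push_cast
  ring

/-- If `h` fails to be nonnegative almost everywhere, then it is bounded away from zero from above
on sets of arbitrarily small positive measure. -/
theorem exists_seq_subsets_of_not_ae_nonneg {T : ℝ} {h : ℝ → ℝ}
    (hh : AEStronglyMeasurable h (volume.restrict (Icc 0 T)))
    (hneg : ¬ ∀ᵐ t ∂(volume.restrict (Icc 0 T)), 0 ≤ h t) :
    ∃ c > 0, ∃ B : ℕ → Set ℝ, ∀ n, B n ⊆ Icc 0 T ∧ MeasurableSet (B n) ∧
      0 < volume.real (B n) ∧ volume.real (B n) ≤ 1 / ((n : ℝ) + 1) ∧ ∀ t ∈ B n, h t ≤ -c := by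
  -- The set {h < 0} is the countable union of the sets {h ≤ -1/(k+1)}, so one of these is not null;
  -- it supplies the constant c.
  obtain ⟨k, hk⟩ : ∃ k : ℕ, (volume.restrict (Icc 0 T)) {t | h t ≤ -(1 / ((k : ℝ) + 1))} ≠ 0 := by
    by_contra! hk
    refine hneg ?_
    rw [ae_iff]
    refine measure_mono_null ?_ (measure_iUnion_null hk)
    intro t ht
    simp only [mem_ofPred_eq, not_le] at ht
    obtain ⟨n, hn⟩ := exists_nat_one_div_lt (neg_pos.2 ht)
    exact mem_iUnion.2 ⟨n, by simp only [mem_ofPred_eq]; linarith⟩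
  have hnull : NullMeasurableSet {t | h t ≤ -(1 / ((k : ℝ) + 1))} (volume.restrict (Icc 0 T)) :=
    nullMeasurableSet_le hh.aemeasurable aemeasurable_const
  obtain ⟨A, hAsub, hA, hAeq⟩ := hnull.exists_measurable_subset_ae_eq
  rw [← measure_congr hAeq, Measure.restrict_apply hA] at hk
  choose B hB using fun n : ℕ => exists_measurable_subset_volume_le
    (hA.inter measurableSet_Icc) hk (ε := 1 / ((n : ℝ) + 1)) (by positivity)
  refine ⟨1 / ((k : ℝ) + 1), by positivity, B, fun n => ?_⟩
  obtain ⟨h1, h2, h3, h4⟩ := hB n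
  refine ⟨h1.trans inter_subset_right, h2, ?_, ?_, fun t ht => hAsub (h1 ht).1⟩
  · exact ENNReal.toReal_pos h3 (h4.trans_lt ENNReal.ofReal_lt_top).ne
  · exact ENNReal.toReal_le_of_le_ofReal (by positivity) h4

/-! ### Control processes: uniform bounds, the adjoint equation, needle variations. -/

section PontryaginSetting

variable {E V : Type*} [NormedAddCommGroup E] [NormedSpace ℝ E] [NormedAddCommGroup V]

/-- A control `u` with values in `U` and a trajectory `z` of `ż = f u z` on `[0,T]`. -/
structure IsControlProcess (T : ℝ) (f : V → E → E) (U : Set V) (z : ℝ → E) (u : ℝ → V) :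
    Prop where
  aestronglyMeasurable : AEStronglyMeasurable u (volume.restrict (Icc 0 T))
  mem : ∀ᵐ t ∂(volume.restrict (Icc 0 T)), u t ∈ U
  continuousOn : ContinuousOn z (Icc 0 T)
  eq_integral : ∀ t ∈ Icc 0 T, z t = z 0 + ∫ s in (0 : ℝ)..t, f (u s) (z s)

/-- Uniform bounds and Lipschitz estimates for the dynamics and the cost on a ball. -/
structure HasBoundsOnBall (f : V → E → E) (L : E → ℝ) (φ : V → ℝ) (U : Set V) (r K : ℝ) :
    Prop where
  pos : 0 < K
  lipschitz_dyn : ∀ v ∈ U, ∀ x y : E, ‖x‖ ≤ r → ‖y‖ ≤ r → ‖f v x - f v y‖ ≤ K * ‖x - y‖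
  lipschitz_cost : ∀ x y : E, ‖x‖ ≤ r → ‖y‖ ≤ r → ‖L x - L y‖ ≤ K * ‖x - y‖
  bound_dyn : ∀ v ∈ U, ∀ x : E, ‖x‖ ≤ r → ‖f v x‖ ≤ K
  bound_cost : ∀ x : E, ‖x‖ ≤ r → ‖L x‖ ≤ K
  bound_control : ∀ v ∈ U, ‖φ v‖ ≤ K

/-- In finite dimension U times a closed ball is compact, and a locally Lipschitz map is bounded and
Lipschitz on a compact set. Adding all the constants, and 1 for positivity, gives a single K. -/
theorem exists_hasBoundsOnBall [FiniteDimensional ℝ E] {f : V → E → E} {L : E → ℝ} {φ : V → ℝ}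
    {U : Set V} (hU : IsCompact U) (hf : LocallyLipschitz (Function.uncurry f))
    (hL : LocallyLipschitz L) (hφ : Continuous φ) (r : ℝ) :
    ∃ K, HasBoundsOnBall f L φ U r K := by
  have := FiniteDimensional.proper ℝ E
  have hball : IsCompact (Metric.closedBall (0 : E) r) := isCompact_closedBall _ _
  have hprod := hU.prod hball
  obtain ⟨K₁, h₁⟩ := (hf.locallyLipschitzOn (s := U ×ˢ Metric.closedBall (0 : E) r)
    ).exists_lipschitzOnWith_of_compact hprod
  obtain ⟨K₂, h₂⟩ := (hL.locallyLipschitzOn (s := Metric.closedBall (0 : E) r)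
    ).exists_lipschitzOnWith_of_compact hball
  obtain ⟨K₃, h₃⟩ := hprod.exists_bound_of_continuousOn hf.continuous.continuousOn
  obtain ⟨K₄, h₄⟩ := hball.exists_bound_of_continuousOn hL.continuous.continuousOn
  obtain ⟨K₅, h₅⟩ := hU.exists_bound_of_continuousOn hφ.continuousOn
  have hle : ∀ a ∈ [(K₁ : ℝ), (K₂ : ℝ), |K₃|, |K₄|, |K₅|],
      a ≤ (K₁ : ℝ) + K₂ + |K₃| + |K₄| + |K₅| + 1 := by
    have := abs_nonneg K₃
    have := abs_nonneg K₄
    have := abs_nonneg K₅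
    have := K₁.2
    have := K₂.2
    intro a ha
    simp only [List.mem_cons, List.not_mem_nil, or_false, NNReal.val_eq_coe] at *
    rcases ha with rfl | rfl | rfl | rfl | rfl <;> linarith
  simp only [List.mem_cons, List.not_mem_nil, or_false, forall_eq_or_imp, forall_eq] at hle
  obtain ⟨l₁, l₂, l₃, l₄, l₅⟩ := hle
  have hmem : ∀ x : E, ‖x‖ ≤ r → x ∈ Metric.closedBall (0 : E) r := fun x hx =>
    mem_closedBall_zero_iff.2 hx
  refine ⟨(K₁ : ℝ) + K₂ + |K₃| + |K₄| + |K₅| + 1, by positivity, ?_, ?_, ?_, ?_, ?_⟩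
  · intro v hv x y hx hy
    have := h₁.dist_le_mul (v, x) ⟨hv, hmem x hx⟩ (v, y) ⟨hv, hmem y hy⟩
    rw [dist_eq_norm, dist_eq_norm, Prod.mk_sub_mk, sub_self, Prod.norm_mk, norm_zero,
      max_eq_right (norm_nonneg _)] at this
    exact this.trans (by gcongr)
  · intro x y hx hy
    have := h₂.dist_le_mul x (hmem x hx) y (hmem y hy)
    rw [dist_eq_norm, dist_eq_norm] at this
    exact this.trans (by gcongr)
  · exact fun v hv x hx => (h₃ (v, x) ⟨hv, hmem x hx⟩).trans ((le_abs_self _).trans l₃)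
  · exact fun x hx => (h₄ x (hmem x hx)).trans ((le_abs_self _).trans l₄)
  · exact fun v hv => (h₅ v hv).trans ((le_abs_self _).trans l₅)

/-- Existence of the solution of a linear backward adjoint equation. -/
theorem exists_adjoint_solution {T K : ℝ} (hT : 0 ≤ T) (hK : 0 < K) {A : ℝ → E →L[ℝ] E}
    {b : ℝ → E →L[ℝ] ℝ} (hA : AEStronglyMeasurable A (volume.restrict (Icc 0 T)))
    (hb : AEStronglyMeasurable b (volume.restrict (Icc 0 T)))
    (hAK : ∀ᵐ t ∂(volume.restrict (Icc 0 T)), ‖A t‖ ≤ K)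
    (hbK : ∀ᵐ t ∂(volume.restrict (Icc 0 T)), ‖b t‖ ≤ K) :
    ∃ ξ : ℝ → E →L[ℝ] ℝ, Continuous ξ ∧
      ∀ t ∈ Icc 0 T, ξ t = ∫ s in t..T, (b s + (ξ s).comp (A s)) := by
  -- Reversing time turns the terminal value problem into an initial value problem. The reflection
  -- preserves the measure, so the almost everywhere bounds survive.
  have hpres : MeasurePreserving (fun t => T - t) (volume.restrict (Icc 0 T))
      (volume.restrict (Icc 0 T)) := by
    have := (Measure.measurePreserving_sub_left (volume : Measure ℝ) T).restrict_preimage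
      (s := Icc 0 T) measurableSet_Icc
    simpa using this
  have hA' := hA.comp_measurePreserving hpres
  have hb' := hb.comp_measurePreserving hpres
  have hAK' := hpres.quasiMeasurePreserving.ae hAK
  have hbK' := hpres.quasiMeasurePreserving.ae hbK
  set g : ℝ → (E →L[ℝ] ℝ) → (E →L[ℝ] ℝ) := fun t x => b (T - t) + x.comp (A (T - t)) with hg
  have hcomp : ∀ w : ℝ → E →L[ℝ] ℝ, Continuous w →
      AEStronglyMeasurable (fun t => g t (w t)) (volume.restrict (Icc 0 T)) := by
    intro w hw
    exact hb'.add ((isBoundedBilinearMap_comp (𝕜 := ℝ) (E := E) (F := E) (G := ℝ)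
      ).continuous.comp_aestronglyMeasurable (hw.aestronglyMeasurable.prodMk hA'))
  have hint : IntegrableOn (fun t => g t 0) (Icc 0 T) := by
    refine Integrable.of_bound (hcomp _ continuous_const) K ?_
    filter_upwards [hbK'] with t ht
    simpa [hg] using ht
  -- The equation is affine, hence globally Lipschitz, so the tube may be taken exactly as wide as
  -- the solution bound requires.
  obtain ⟨w, hw, -, -, heq⟩ := exists_integral_solution hT hK (g := g) hcomp
    (ρ := 2 * (∫ t in Icc 0 T, ‖g t 0‖) * Real.exp (2 * K * T)) (by
      filter_upwards [hAK'] with t ht x y _ _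
      simp only [hg, add_sub_add_left_eq_sub, ← ContinuousLinearMap.sub_comp]
      refine (ContinuousLinearMap.opNorm_comp_le _ _).trans ?_
      rw [mul_comm]
      gcongr) hint le_rfl le_rfl
  refine ⟨fun t => w (T - t), by fun_prop, fun t ht => ?_⟩
  have h1 : T - t ∈ Icc 0 T := ⟨by linarith [ht.2], by linarith [ht.1]⟩
  simp only [heq _ h1]
  have := intervalIntegral.integral_comp_sub_left (a := t) (b := T)
    (fun s => g s (w s)) T
  rw [sub_self] at this
  rw [← this]
  simp [hg]

variable {T r K : ℝ} {f : V → E → E} {L : E → ℝ} {φ : V → ℝ} {U : Set V} {z : ℝ → E} {u : ℝ → V}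

theorem IsControlProcess.aestronglyMeasurable_dyn [SecondCountableTopology E]
    (hp : IsControlProcess T f U z u) (hf : Continuous (Function.uncurry f)) {u' : ℝ → V}
    (hu' : AEStronglyMeasurable u' (volume.restrict (Icc 0 T))) {w : ℝ → E} (hw : Continuous w) :
    AEStronglyMeasurable (fun t => f (u' t) (z t + w t)) (volume.restrict (Icc 0 T)) :=
  hf.comp_aestronglyMeasurable (hu'.prodMk
    ((hp.continuousOn.add hw.continuousOn).aestronglyMeasurable measurableSet_Icc))

theorem aestronglyMeasurable_piecewise_const {B : Set ℝ} (hB : MeasurableSet B)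
    [DecidablePred (· ∈ B)] {μ : Measure ℝ} (hu : AEStronglyMeasurable u μ) (v : V) :
    AEStronglyMeasurable (B.piecewise (fun _ => v) u) μ :=
  AEStronglyMeasurable.piecewise hB aestronglyMeasurable_const hu.restrict

open Classical in
/-- The trajectory of a needle variation stays close to the original one, proportionally to the
measure of the set on which the control is changed. -/
theorem IsControlProcess.exists_perturbation [FiniteDimensional ℝ E]
    (hT : 0 ≤ T) (hp : IsControlProcess T f U z u) (hf : Continuous (Function.uncurry f))
    (hr : ∀ t ∈ Icc 0 T, ‖z t‖ ≤ r) (hK : HasBoundsOnBall f L φ U (r + 1) K)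
    {B : Set ℝ} (hB : MeasurableSet B) (hBT : B ⊆ Icc 0 T) {v : V} (hv : v ∈ U)
    (hsmall : 4 * K * Real.exp (2 * K * T) * volume.real B ≤ 1) :
    ∃ δ : ℝ → E, Continuous δ ∧ δ 0 = 0 ∧
      (∀ t ∈ Icc 0 T, ‖δ t‖ ≤ 4 * K * Real.exp (2 * K * T) * volume.real B) ∧
      (∀ t ∈ Icc 0 T, δ t = ∫ s in (0 : ℝ)..t,
        (f (B.piecewise (fun _ => v) u s) (z s + δ s) - f (u s) (z s))) ∧
      IsControlProcess T f U (fun t => z t + δ t) (B.piecewise (fun _ => v) u) := by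
  have := FiniteDimensional.complete ℝ E
  have := FiniteDimensional.proper ℝ E
  set u' := B.piecewise (fun _ => v) u with hu'
  have hmeas' := aestronglyMeasurable_piecewise_const hB hp.aestronglyMeasurable v
  have hmem' : ∀ᵐ t ∂(volume.restrict (Icc 0 T)), u' t ∈ U := by
    filter_upwards [hp.mem] with t ht
    by_cases h : t ∈ B <;> simp [hu', h, ht, hv]
  have hmz : AEStronglyMeasurable (fun t => f (u t) (z t)) (volume.restrict (Icc 0 T)) := by
    simpa using hp.aestronglyMeasurable_dyn hf hp.aestronglyMeasurable
      (continuous_const (y := (0 : E)))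
  have hintz : IntegrableOn (fun t => f (u t) (z t)) (Icc 0 T) := by
    refine Integrable.of_bound hmz K ?_
    filter_upwards [hp.mem, ae_restrict_mem measurableSet_Icc] with t ht hmem
    exact hK.bound_dyn _ ht _ ((hr t hmem).trans (by linarith))
  -- The unknown is the displacement δ. At zero displacement the field vanishes off B and is at most
  -- 2K on B, so a = 2K|B|, and the bound 2a e^(2KT) becomes 4K e^(2KT)|B|.
  set g : ℝ → E → E := fun t w => f (u' t) (z t + w) - f (u t) (z t) with hg
  have hgm : ∀ w : ℝ → E, Continuous w →
      AEStronglyMeasurable (fun t => g t (w t)) (volume.restrict (Icc 0 T)) := fun w hw =>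
    (hp.aestronglyMeasurable_dyn hf hmeas' hw).sub hmz
  have hg0 : ∀ᵐ t ∂(volume.restrict (Icc 0 T)), ‖g t 0‖ ≤ B.indicator (fun _ => 2 * K) t := by
    filter_upwards [hp.mem, ae_restrict_mem measurableSet_Icc] with t ht hmem
    have hz : ‖z t‖ ≤ r + 1 := (hr t hmem).trans (by linarith)
    by_cases h : t ∈ B
    · simp only [hg, hu', h, piecewise_eq_of_mem, add_zero, indicator_of_mem]
      refine (norm_sub_le _ _).trans ?_
      linarith [hK.bound_dyn _ hv _ hz, hK.bound_dyn _ ht _ hz]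
    · simp [hg, hu', h]
  have hindint : Integrable (B.indicator fun _ => 2 * K) (volume.restrict (Icc 0 T)) :=
    (integrable_const _).indicator hB
  have hint : IntegrableOn (fun t => g t 0) (Icc 0 T) :=
    hindint.mono' (hgm _ continuous_const) hg0
  have ha : ∫ t in Icc 0 T, ‖g t 0‖ ≤ 2 * K * volume.real B := by
    refine (integral_mono_ae hint.norm hindint hg0).trans (le_of_eq ?_)
    rw [setIntegral_indicator hB, inter_eq_right.2 hBT, setIntegral_const, smul_eq_mul, mul_comm]
  -- With a tube of radius 1 the perturbed trajectory stays in the ball of radius r + 1, where K is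
  -- valid; the smallness of B keeps the solution in the tube.
  obtain ⟨δ, hδ, hδle, hδint, hδeq⟩ := exists_integral_solution hT hK.pos (ρ := 1) hgm (by
      filter_upwards [hmem', ae_restrict_mem measurableSet_Icc] with t ht hmem x y hx hy
      have := hK.lipschitz_dyn _ ht (z t + x) (z t + y)
        ((norm_add_le _ _).trans (add_le_add (hr t hmem) hx))
        ((norm_add_le _ _).trans (add_le_add (hr t hmem) hy))
      simpa [hg] using this) hint ha (by linarith)
  refine ⟨δ, hδ, ?_, fun t ht => (hδle t ht).trans (by linarith), hδeq, ⟨hmeas', hmem',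
    hp.continuousOn.add hδ.continuousOn, fun t ht => ?_⟩⟩
  · rw [hδeq 0 ⟨le_rfl, hT⟩, intervalIntegral.integral_same]
  · have h0 : (0 : ℝ) ∈ Icc 0 T := ⟨le_rfl, hT⟩
    have hδ0 : δ 0 = 0 := by rw [hδeq 0 h0, intervalIntegral.integral_same]
    have h1 : ∫ s in (0 : ℝ)..t, f (u' s) (z s + δ s)
        = (∫ s in (0 : ℝ)..t, g s (δ s)) + ∫ s in (0 : ℝ)..t, f (u s) (z s) := by
      rw [← intervalIntegral.integral_add (hδint.intervalIntegrable_of_mem_Icc h0 ht)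
        (hintz.intervalIntegrable_of_mem_Icc h0 ht)]
      simp [hg]
    rw [h1, ← hδeq t ht, hδ0, hp.eq_integral t ht]
    abel

end PontryaginSetting

/-! ### The Hamiltonian: remainder, increment, measurability. -/

section PontryaginPrinciple

variable {E V : Type*} [NormedAddCommGroup E] [NormedSpace ℝ E]

/-- The first order Taylor remainder, at the point `(x, v)`, of the running cost plus the
momentum `η` applied to the dynamics. -/
def hamiltonianRemainder (f : V → E → E) (L : E → ℝ) (v : V) (x : E) (η : E →L[ℝ] ℝ) (w : E) : ℝ :=
  L (x + w) - L x - fderiv ℝ L x w + η (f v (x + w) - f v x - fderiv ℝ (f v) x w)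

/-- The increment of the Hamiltonian when the control value `v'` is replaced by `v`. -/
def hamiltonianIncrement (f : V → E → E) (φ : V → ℝ) (v v' : V) (x : E) (η : E →L[ℝ] ℝ) : ℝ :=
  φ v - φ v' + η (f v x - f v' x)

/-- The integrand of the adjoint equation. -/
def adjointField (f : V → E → E) (L : E → ℝ) (v : V) (x : E) (η : E →L[ℝ] ℝ) : E →L[ℝ] ℝ :=
  fderiv ℝ L x + η.comp (fderiv ℝ (f v) x)

theorem hamiltonianRemainder_isLittleO {f : V → E → E} {L : E → ℝ} {v : V} {x : E}
    (η : E →L[ℝ] ℝ) (hf : DifferentiableAt ℝ (f v) x) (hL : DifferentiableAt ℝ L x) :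
    hamiltonianRemainder f L v x η =o[𝓝 0] (fun w => w) := by
  have h1 := hasFDerivAt_iff_isLittleO_nhds_zero.1 hL.hasFDerivAt
  have h2 := hasFDerivAt_iff_isLittleO_nhds_zero.1 hf.hasFDerivAt
  exact h1.add ((η.isBigO_comp _ _).trans_isLittleO h2)

namespace HasBoundsOnBall

variable {r K : ℝ} {f : V → E → E} {L : E → ℝ} {φ : V → ℝ} {U : Set V}

/-- A Lipschitz constant near a point bounds the derivative there. The extra 1 in the radius makes
the larger ball a neighbourhood of every point of the smaller one. -/
theorem norm_fderiv_dyn_le (hK : HasBoundsOnBall f L φ U (r + 1) K) {v : V} (hv : v ∈ U) {x : E}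
    (hx : ‖x‖ ≤ r) : ‖fderiv ℝ (f v) x‖ ≤ K := by
  have hs : Metric.closedBall (0 : E) (r + 1) ∈ 𝓝 x :=
    mem_of_superset (Metric.ball_mem_nhds x one_pos) fun y hy => by
      rw [mem_closedBall_zero_iff]
      rw [mem_ball_iff_norm] at hy
      have := norm_add_le x (y - x)
      rw [add_sub_cancel] at this
      linarith
  have := norm_fderiv_le_of_lipschitzOn ℝ (C := ⟨K, hK.pos.le⟩) hs
    (LipschitzOnWith.of_dist_le_mul (f := f v) fun a ha b hb => by
      rw [dist_eq_norm, dist_eq_norm]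
      exact hK.lipschitz_dyn v hv a b (mem_closedBall_zero_iff.1 ha) (mem_closedBall_zero_iff.1 hb))
  exact this

theorem norm_fderiv_cost_le (hK : HasBoundsOnBall f L φ U (r + 1) K) {x : E}
    (hx : ‖x‖ ≤ r) : ‖fderiv ℝ L x‖ ≤ K := by
  have hs : Metric.closedBall (0 : E) (r + 1) ∈ 𝓝 x :=
    mem_of_superset (Metric.ball_mem_nhds x one_pos) fun y hy => by
      rw [mem_closedBall_zero_iff]
      rw [mem_ball_iff_norm] at hy
      have := norm_add_le x (y - x)
      rw [add_sub_cancel] at this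
      linarith
  have := norm_fderiv_le_of_lipschitzOn ℝ (C := ⟨K, hK.pos.le⟩) hs
    (LipschitzOnWith.of_dist_le_mul (f := L) fun a ha b hb => by
      rw [dist_eq_norm, dist_eq_norm]
      exact hK.lipschitz_cost a b (mem_closedBall_zero_iff.1 ha) (mem_closedBall_zero_iff.1 hb))
  exact this

/-- A bound linear in w, without smallness: after division by |B| it provides the dominating
constant, while the little-o estimate provides the pointwise limit. -/
theorem norm_hamiltonianRemainder_le (hK : HasBoundsOnBall f L φ U (r + 1) K) {v : V} (hv : v ∈ U)
    {x w : E} (hx : ‖x‖ ≤ r) (hw : ‖w‖ ≤ 1) (η : E →L[ℝ] ℝ) :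
    ‖hamiltonianRemainder f L v x η w‖ ≤ (1 + ‖η‖) * (2 * K) * ‖w‖ := by
  have hxw : ‖x + w‖ ≤ r + 1 := (norm_add_le _ _).trans (add_le_add hx hw)
  have hx' : ‖x‖ ≤ r + 1 := hx.trans (by linarith)
  have h1 := hK.lipschitz_cost _ _ hxw hx'
  have h2 := hK.lipschitz_dyn v hv _ _ hxw hx'
  rw [add_sub_cancel_left] at h1 h2
  have h3 := (fderiv ℝ L x).le_of_opNorm_le (hK.norm_fderiv_cost_le hx) w
  have h4 := (fderiv ℝ (f v) x).le_of_opNorm_le (hK.norm_fderiv_dyn_le hv hx) w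
  have h5 := η.le_opNorm (f v (x + w) - f v x - fderiv ℝ (f v) x w)
  have h6 := norm_sub_le (L (x + w) - L x) (fderiv ℝ L x w)
  have h7 := norm_sub_le (f v (x + w) - f v x) (fderiv ℝ (f v) x w)
  have h8 : ‖η‖ * ‖f v (x + w) - f v x - fderiv ℝ (f v) x w‖ ≤ ‖η‖ * (K * ‖w‖ + K * ‖w‖) :=
    mul_le_mul_of_nonneg_left (by linarith) (norm_nonneg _)
  refine (norm_add_le _ _).trans ?_
  linarith

/-- Lipschitz dependence of the Hamiltonian increment on the state. -/
theorem norm_hamiltonianIncrement_sub_le (hK : HasBoundsOnBall f L φ U r K) {v v' : V}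
    (hv : v ∈ U) (hv' : v' ∈ U) {x y : E} (hx : ‖x‖ ≤ r) (hy : ‖y‖ ≤ r) (η : E →L[ℝ] ℝ) :
    ‖hamiltonianIncrement f φ v v' x η - hamiltonianIncrement f φ v v' y η‖
      ≤ ‖η‖ * (2 * K) * ‖x - y‖ := by
  have h1 := hK.lipschitz_dyn v hv x y hx hy
  have h2 := hK.lipschitz_dyn v' hv' x y hx hy
  have h3 := norm_sub_le (f v x - f v y) (f v' x - f v' y)
  have h4 := η.le_opNorm ((f v x - f v y) - (f v' x - f v' y))
  have h5 : ‖η‖ * ‖(f v x - f v y) - (f v' x - f v' y)‖ ≤ ‖η‖ * (K * ‖x - y‖ + K * ‖x - y‖) :=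
    mul_le_mul_of_nonneg_left (by linarith) (norm_nonneg _)
  have h6 : hamiltonianIncrement f φ v v' x η - hamiltonianIncrement f φ v v' y η
      = η ((f v x - f v y) - (f v' x - f v' y)) := by
    simp only [hamiltonianIncrement, map_sub]
    ring
  rw [h6]
  linarith

end HasBoundsOnBall

variable [NormedAddCommGroup V] {T : ℝ} {f : V → E → E} {U : Set V} {z : ℝ → E} {u : ℝ → V}

/-- The derivative need not be continuous in the state, but for jointly continuous f it is jointly
Borel in control and state; composing with u and z keeps measurability. -/
theorem IsControlProcess.aestronglyMeasurable_fderiv_dyn [FiniteDimensional ℝ E]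
    (hp : IsControlProcess T f U z u)
    (hf : Continuous (Function.uncurry f)) :
    AEStronglyMeasurable (fun t => fderiv ℝ (f (u t)) (z t)) (volume.restrict (Icc 0 T)) := by
  have := FiniteDimensional.complete ℝ E
  have := FiniteDimensional.proper ℝ E
  borelize E V (E →L[ℝ] E)
  exact ((measurable_fderiv_with_param ℝ hf).comp_aemeasurable
    (hp.aestronglyMeasurable.aemeasurable.prodMk
      (hp.continuousOn.aemeasurable measurableSet_Icc))).aestronglyMeasurable

theorem IsControlProcess.aestronglyMeasurable_fderiv_cost [FiniteDimensional ℝ E]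
    (hp : IsControlProcess T f U z u)
    (L : E → ℝ) :
    AEStronglyMeasurable (fun t => fderiv ℝ L (z t)) (volume.restrict (Icc 0 T)) := by
  borelize E
  exact ((measurable_fderiv ℝ L).comp_aemeasurable
    (hp.continuousOn.aemeasurable measurableSet_Icc)).aestronglyMeasurable

theorem aestronglyMeasurable_clm_apply {μ : Measure ℝ} {F : Type*} [NormedAddCommGroup F]
    [NormedSpace ℝ F] {A : ℝ → E →L[ℝ] F} {w : ℝ → E}
    (hA : AEStronglyMeasurable A μ) (hw : AEStronglyMeasurable w μ) :
    AEStronglyMeasurable (fun t => A t (w t)) μ :=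
  isBoundedBilinearMap_apply.continuous.comp_aestronglyMeasurable (hA.prodMk hw)

end PontryaginPrinciple

/-! ### Expansion of the cost under a needle variation. -/

section NeedleVariation

variable {E V : Type*} [NormedAddCommGroup E] [NormedSpace ℝ E]
  [NormedAddCommGroup V] {T r K : ℝ} {f : V → E → E} {L : E → ℝ} {φ : V → ℝ} {U : Set V}
  {z : ℝ → E} {u : ℝ → V}

theorem IsControlProcess.ae_norm_adjointField_le
    (hp : IsControlProcess T f U z u) (hr : ∀ t ∈ Icc 0 T, ‖z t‖ ≤ r)
    (hK : HasBoundsOnBall f L φ U (r + 1) K) {Ξ : ℝ} {ξ : ℝ → E →L[ℝ] ℝ}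
    (hΞ : ∀ t ∈ Icc 0 T, ‖ξ t‖ ≤ Ξ) :
    ∀ᵐ t ∂(volume.restrict (Icc 0 T)), ‖adjointField f L (u t) (z t) (ξ t)‖ ≤ K + Ξ * K := by
  filter_upwards [hp.mem, ae_restrict_mem measurableSet_Icc] with t ht hmem
  refine (norm_add_le _ _).trans (add_le_add (hK.norm_fderiv_cost_le (hr t hmem)) ?_)
  exact (ContinuousLinearMap.opNorm_comp_le _ _).trans (mul_le_mul (hΞ t hmem)
    (hK.norm_fderiv_dyn_le ht (hr t hmem)) (norm_nonneg _) ((norm_nonneg _).trans (hΞ t hmem)))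

variable [FiniteDimensional ℝ E]

theorem IsControlProcess.aestronglyMeasurable_hamiltonianRemainder
    (hp : IsControlProcess T f U z u) (hf : Continuous (Function.uncurry f)) (hL : Continuous L)
    {ξ : ℝ → E →L[ℝ] ℝ} (hξ : Continuous ξ) {δ : ℝ → E} (hδ : Continuous δ) :
    AEStronglyMeasurable (fun t => hamiltonianRemainder f L (u t) (z t) (ξ t) (δ t))
      (volume.restrict (Icc 0 T)) := by
  have := FiniteDimensional.proper ℝ E
  have hz := hp.continuousOn.aestronglyMeasurable (μ := volume) measurableSet_Icc
  have h0 := hp.aestronglyMeasurable_dyn hf hp.aestronglyMeasurable (continuous_const (y := (0 : E)))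
  simp only [add_zero] at h0
  exact (((hL.comp_aestronglyMeasurable (hz.add hδ.aestronglyMeasurable)).sub
    (hL.comp_aestronglyMeasurable hz)).sub (aestronglyMeasurable_clm_apply
      (hp.aestronglyMeasurable_fderiv_cost L) hδ.aestronglyMeasurable)).add
    (aestronglyMeasurable_clm_apply hξ.aestronglyMeasurable
      (((hp.aestronglyMeasurable_dyn hf hp.aestronglyMeasurable hδ).sub h0).sub
        (aestronglyMeasurable_clm_apply (hp.aestronglyMeasurable_fderiv_dyn hf)
          hδ.aestronglyMeasurable)))

theorem IsControlProcess.aestronglyMeasurable_hamiltonianIncrement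
    (hp : IsControlProcess T f U z u) (hf : Continuous (Function.uncurry f)) (hφ : Continuous φ)
    (v : V) {ξ : ℝ → E →L[ℝ] ℝ} (hξ : Continuous ξ) {w : ℝ → E} (hw : Continuous w) :
    AEStronglyMeasurable (fun t => hamiltonianIncrement f φ v (u t) (z t + w t) (ξ t))
      (volume.restrict (Icc 0 T)) := by
  have := FiniteDimensional.proper ℝ E
  exact (aestronglyMeasurable_const.sub (hφ.comp_aestronglyMeasurable hp.aestronglyMeasurable)).add
    (aestronglyMeasurable_clm_apply hξ.aestronglyMeasurable
      ((hp.aestronglyMeasurable_dyn hf aestronglyMeasurable_const hw).sub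
        (hp.aestronglyMeasurable_dyn hf hp.aestronglyMeasurable hw)))

theorem IsControlProcess.aestronglyMeasurable_adjointField
    (hp : IsControlProcess T f U z u) (hf : Continuous (Function.uncurry f))
    {ξ : ℝ → E →L[ℝ] ℝ} (hξ : Continuous ξ) :
    AEStronglyMeasurable (fun t => adjointField f L (u t) (z t) (ξ t))
      (volume.restrict (Icc 0 T)) :=
  (hp.aestronglyMeasurable_fderiv_cost L).add
    ((isBoundedBilinearMap_comp (𝕜 := ℝ) (E := E) (F := E) (G := ℝ)
      ).continuous.comp_aestronglyMeasurable
      (hξ.aestronglyMeasurable.prodMk (hp.aestronglyMeasurable_fderiv_dyn hf)))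

theorem IsControlProcess.integrable_cost (hp : IsControlProcess T f U z u)
    (hr : ∀ t ∈ Icc 0 T, ‖z t‖ ≤ r) (hK : HasBoundsOnBall f L φ U r K)
    (hL : Continuous L) (hφ : Continuous φ) :
    IntegrableOn (fun t => L (z t) + φ (u t)) (Icc 0 T) := by
  have := FiniteDimensional.proper ℝ E
  refine Integrable.of_bound ((hL.comp_aestronglyMeasurable (hp.continuousOn.aestronglyMeasurable
    measurableSet_Icc)).add (hφ.comp_aestronglyMeasurable hp.aestronglyMeasurable)) (K + K) ?_
  filter_upwards [hp.mem, ae_restrict_mem measurableSet_Icc] with t ht hmem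
  exact (norm_add_le _ _).trans
    (add_le_add (hK.bound_cost _ (hr t hmem)) (hK.bound_control _ ht))

open Classical in
/-- First order expansion of the cost under a needle variation. -/
theorem IsControlProcess.cost_sub_le (hp : IsControlProcess T f U z u)
    (hf : Continuous (Function.uncurry f)) (hL : Continuous L) (hφ : Continuous φ)
    (hr : ∀ t ∈ Icc 0 T, ‖z t‖ ≤ r) (hK : HasBoundsOnBall f L φ U (r + 1) K)
    {Ξ : ℝ} {ξ : ℝ → E →L[ℝ] ℝ} (hξ : Continuous ξ) (hΞ : ∀ t ∈ Icc 0 T, ‖ξ t‖ ≤ Ξ)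
    (hξeq : ∀ t ∈ Icc 0 T, ξ t = ∫ s in t..T, adjointField f L (u s) (z s) (ξ s))
    {B : Set ℝ} (hB : MeasurableSet B) (hBT : B ⊆ Icc 0 T) {v : V} (hv : v ∈ U)
    {δ : ℝ → E} (hδ : Continuous δ) {D : ℝ} (hD1 : D ≤ 1) (hδD : ∀ t ∈ Icc 0 T, ‖δ t‖ ≤ D)
    (hδeq : ∀ t ∈ Icc 0 T, δ t = ∫ s in (0 : ℝ)..t,
      (f (B.piecewise (fun _ => v) u s) (z s + δ s) - f (u s) (z s)))
    (hp' : IsControlProcess T f U (fun t => z t + δ t) (B.piecewise (fun _ => v) u)) {c : ℝ}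
    (hc : ∀ t ∈ B, hamiltonianIncrement f φ v (u t) (z t) (ξ t) ≤ -c) :
    (∫ t in Icc 0 T, (L (z t + δ t) + φ (B.piecewise (fun _ => v) u t)))
        - ∫ t in Icc 0 T, (L (z t) + φ (u t))
      ≤ (∫ t in Icc 0 T, ‖hamiltonianRemainder f L (u t) (z t) (ξ t) (δ t)‖)
        + (-c + Ξ * (2 * K) * D) * volume.real B := by
  have := FiniteDimensional.proper ℝ E
  have := FiniteDimensional.complete ℝ E
  set μ := volume.restrict (Icc 0 T) with hμ
  set u' := B.piecewise (fun _ => v) u with hu'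
  set p : ℝ → E →L[ℝ] ℝ := fun t => adjointField f L (u t) (z t) (ξ t) with hpdef
  set w : ℝ → E := fun s => f (u' s) (z s + δ s) - f (u s) (z s) with hw
  set q : ℝ → ℝ := fun t => hamiltonianRemainder f L (u t) (z t) (ξ t) (δ t) with hq
  have hr1 : ∀ t ∈ Icc 0 T, ‖z t‖ ≤ r + 1 := fun t ht => (hr t ht).trans (by linarith)
  have hr' : ∀ t ∈ Icc 0 T, ‖z t + δ t‖ ≤ r + 1 := fun t ht =>
    (norm_add_le _ _).trans (add_le_add (hr t ht) ((hδD t ht).trans hD1))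
  have hz0 := hp.aestronglyMeasurable_dyn hf hp.aestronglyMeasurable
    (continuous_const (y := (0 : E)))
  simp only [add_zero] at hz0
  have hp_int : IntegrableOn p (Icc 0 T) :=
    Integrable.of_bound (hp.aestronglyMeasurable_adjointField hf hξ) (K + Ξ * K)
      (hp.ae_norm_adjointField_le hr hK hΞ)
  have hwm : AEStronglyMeasurable w μ :=
    (hp.aestronglyMeasurable_dyn hf hp'.aestronglyMeasurable hδ).sub hz0
  have hwb : ∀ᵐ t ∂μ, ‖w t‖ ≤ K + K := by
    filter_upwards [hp.mem, hp'.mem, ae_restrict_mem measurableSet_Icc] with t ht ht' hmem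
    exact (norm_sub_le _ _).trans (add_le_add (hK.bound_dyn _ ht' _ (hr' t hmem))
      (hK.bound_dyn _ ht _ (hr1 t hmem)))
  have hw_int : IntegrableOn w (Icc 0 T) := Integrable.of_bound hwm (K + K) hwb
  have hξw_int : Integrable (fun t => ξ t (w t)) μ := by
    refine Integrable.of_bound (aestronglyMeasurable_clm_apply hξ.aestronglyMeasurable hwm)
      (Ξ * (K + K)) ?_
    filter_upwards [hwb, ae_restrict_mem measurableSet_Icc] with t ht hmem
    exact ((ξ t).le_opNorm _).trans (mul_le_mul (hΞ t hmem) ht (norm_nonneg _)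
      ((norm_nonneg _).trans (hΞ t hmem)))
  have hpδ_int : Integrable (fun t => p t (δ t)) μ := by
    refine (hp_int.norm.mul_const D).mono'
      (aestronglyMeasurable_clm_apply hp_int.aestronglyMeasurable hδ.aestronglyMeasurable) ?_
    filter_upwards [ae_restrict_mem measurableSet_Icc] with t hmem
    exact ((p t).le_opNorm _).trans (mul_le_mul_of_nonneg_left (hδD t hmem) (norm_nonneg _))
  have hq_int : Integrable q μ := by
    refine Integrable.of_bound (hp.aestronglyMeasurable_hamiltonianRemainder hf hL hξ hδ)
      ((1 + Ξ) * (2 * K) * 1) ?_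
    filter_upwards [hp.mem, ae_restrict_mem measurableSet_Icc] with t ht hmem
    have hK0 := hK.pos.le
    have hδ1 := (hδD t hmem).trans hD1
    have hΞt := hΞ t hmem
    have := (norm_nonneg _).trans hΞt
    refine (hK.norm_hamiltonianRemainder_le ht (hr t hmem) hδ1 _).trans ?_
    gcongr
  -- Since ξ is the backward integral of p and δ the forward integral of w, duality makes the terms
  -- linear in δ cancel in the integrated cost.
  have hdual : ∫ t in Icc 0 T, ξ t (w t) = ∫ t in Icc 0 T, p t (δ t) := by
    have h1 : ∫ t in Icc 0 T, ξ t (w t) = ∫ s in Icc 0 T, (∫ t in s..T, p t) (w s) :=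
      setIntegral_congr_fun measurableSet_Icc fun t ht => congrArg (fun η => η (w t)) (hξeq t ht)
    rw [h1, integral_duality hp_int hw_int]
    exact setIntegral_congr_fun measurableSet_Icc fun t ht => congrArg (p t) (hδeq t ht).symm
  have hcost := hp.integrable_cost hr1 hK hL hφ
  have hcost' := hp'.integrable_cost hr' hK hL hφ
  rw [← integral_sub hcost' hcost]
  -- The remainder q is taken with the old control everywhere. On B this leaves the Hamiltonian
  -- increment at the perturbed state; moving it back to z costs at most 2KΞD.
  have hpoint : ∀ᵐ t ∂μ, (L (z t + δ t) + φ (u' t)) - (L (z t) + φ (u t))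
      ≤ ‖q t‖ + B.indicator (fun _ => -c + Ξ * (2 * K) * D) t + (p t (δ t) - ξ t (w t)) := by
    filter_upwards [hp.mem, ae_restrict_mem measurableSet_Icc] with t ht hmem
    have hqt : q t ≤ ‖q t‖ := le_abs_self _
    by_cases h : t ∈ B
    · have h1 := hK.norm_hamiltonianIncrement_sub_le (φ := φ) hv ht (hr' t hmem) (hr1 t hmem) (ξ t)
      have h2 := hc t h
      have h3 : ‖ξ t‖ * (2 * K) * ‖z t + δ t - z t‖ ≤ Ξ * (2 * K) * D := by
        have hK0 := hK.pos.le
        have hΞt := hΞ t hmem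
        have hδt := hδD t hmem
        have := (norm_nonneg _).trans hΞt
        rw [add_sub_cancel_left]
        gcongr
      have h4 : (L (z t + δ t) + φ (u' t)) - (L (z t) + φ (u t))
          = q t + hamiltonianIncrement f φ v (u t) (z t + δ t) (ξ t)
            + (p t (δ t) - ξ t (w t)) := by
        simp only [hq, hpdef, hw, hu', h, piecewise_eq_of_mem, hamiltonianRemainder,
          hamiltonianIncrement, adjointField, map_sub, add_apply,
          ContinuousLinearMap.comp_apply]
        ring
      have h5 := (le_abs_self _).trans h1
      rw [h4, indicator_of_mem h]
      linarith
    · have h4 : (L (z t + δ t) + φ (u' t)) - (L (z t) + φ (u t))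
          = q t + (p t (δ t) - ξ t (w t)) := by
        simp only [hq, hpdef, hw, hu', h, not_false_eq_true, piecewise_eq_of_notMem,
          hamiltonianRemainder, adjointField, map_sub, add_apply,
          ContinuousLinearMap.comp_apply]
        ring
      rw [h4, indicator_of_notMem h]
      linarith
  have hind : Integrable (B.indicator fun _ => -c + Ξ * (2 * K) * D) μ :=
    (integrable_const _).indicator hB
  have h1 : Integrable (fun t => ‖q t‖ + B.indicator (fun _ => -c + Ξ * (2 * K) * D) t) μ :=
    hq_int.norm.add hind
  have h2 : Integrable (fun t => p t (δ t) - ξ t (w t)) μ := hpδ_int.sub hξw_int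
  refine (integral_mono_ae (hcost'.sub hcost) (h1.add h2) hpoint).trans (le_of_eq ?_)
  have h3 : ∫ t, B.indicator (fun _ => -c + Ξ * (2 * K) * D) t ∂μ
      = (-c + Ξ * (2 * K) * D) * volume.real B := by
    rw [hμ, setIntegral_indicator hB, inter_eq_right.2 hBT, setIntegral_const, smul_eq_mul,
      mul_comm]
  have h4 : ∫ t, (p t (δ t) - ξ t (w t)) ∂μ = 0 := by
    rw [integral_sub hpδ_int hξw_int, hdual, sub_self]
  calc _ = ∫ t, ((‖q t‖ + B.indicator (fun _ => -c + Ξ * (2 * K) * D) t)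
        + (p t (δ t) - ξ t (w t))) ∂μ := rfl
    _ = _ := by rw [integral_add h1 h2, integral_add hq_int.norm hind, h3, h4, add_zero]

end NeedleVariation

/-! ### Pontryagin's principle. -/

section MaximumPrinciple

variable {E V : Type*} [NormedAddCommGroup E] [NormedSpace ℝ E] [FiniteDimensional ℝ E]
  [NormedAddCommGroup V] {T r K : ℝ} {f : V → E → E} {L : E → ℝ} {φ : V → ℝ} {U : Set V}
  {z : ℝ → E} {u : ℝ → V}

/-- Otherwise there are sets of measure β → 0 on which the increment is at most -c. Optimality
against needle variations on them, divided by β, bounds c by a quantity tending to zero. -/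
theorem IsControlProcess.ae_hamiltonianIncrement_nonneg (hT : 0 ≤ T)
    (hp : IsControlProcess T f U z u)
    (hf : Continuous (Function.uncurry f)) (hf' : ∀ v, Differentiable ℝ (f v))
    (hL : Differentiable ℝ L) (hφ : Continuous φ)
    (hr : ∀ t ∈ Icc 0 T, ‖z t‖ ≤ r) (hK : HasBoundsOnBall f L φ U (r + 1) K)
    {ξ : ℝ → E →L[ℝ] ℝ} (hξ : Continuous ξ)
    (hξeq : ∀ t ∈ Icc 0 T, ξ t = ∫ s in t..T, adjointField f L (u s) (z s) (ξ s))
    (hmin : ∀ z' u', IsControlProcess T f U z' u' → z' 0 = z 0 →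
      ∫ t in Icc 0 T, (L (z t) + φ (u t)) ≤ ∫ t in Icc 0 T, (L (z' t) + φ (u' t)))
    {v : V} (hv : v ∈ U) :
    ∀ᵐ t ∂(volume.restrict (Icc 0 T)), 0 ≤ hamiltonianIncrement f φ v (u t) (z t) (ξ t) := by
  classical
  by_contra hneg
  have hhm := hp.aestronglyMeasurable_hamiltonianIncrement hf hφ v hξ
    (continuous_const (y := (0 : E)))
  simp only [add_zero] at hhm
  obtain ⟨c, hc, B, hB⟩ := exists_seq_subsets_of_not_ae_nonneg hhm hneg
  obtain ⟨Ξ, hΞ⟩ := isCompact_Icc.exists_bound_of_continuousOn (hξ.continuousOn (s := Icc 0 T))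
  have hΞ0 : 0 ≤ Ξ := (norm_nonneg _).trans (hΞ 0 ⟨le_rfl, hT⟩)
  have hK0 := hK.pos
  set C := 4 * K * Real.exp (2 * K * T) with hC
  have hC0 : 0 < C := by positivity
  -- Dropping the first n₀ sets ensures Cβ ≤ 1, so every perturbed trajectory exists in the unit
  -- tube.
  obtain ⟨n₀, hn₀⟩ := exists_nat_one_div_lt (one_div_pos.2 hC0)
  set β : ℕ → ℝ := fun n => volume.real (B (n + n₀)) with hβ
  have hβpos : ∀ n, 0 < β n := fun n => (hB _).2.2.1
  have hβle : ∀ n, β n ≤ 1 / (((n + n₀ : ℕ) : ℝ) + 1) := fun n => (hB _).2.2.2.1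
  have hβ0 : Tendsto β atTop (𝓝 0) :=
    squeeze_zero (fun n => (hβpos n).le) hβle
      ((tendsto_add_atTop_iff_nat n₀).2 (tendsto_one_div_add_atTop_nhds_zero_nat (𝕜 := ℝ)))
  have hCβ : ∀ n, C * β n ≤ 1 := fun n => by
    have h1 : β n ≤ 1 / C := (hβle n).trans (le_trans (by
      refine one_div_le_one_div_of_le (by positivity) ?_
      push_cast
      have : (0 : ℝ) ≤ n := n.cast_nonneg
      linarith) hn₀.le)
    calc C * β n ≤ C * (1 / C) := by gcongr
      _ = 1 := by field_simp
  choose δ hδ hδ0 hδle hδeq hδp using fun n : ℕ => hp.exists_perturbation hT hf hr hK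
    (hB (n + n₀)).2.1 (hB (n + n₀)).1 hv (hCβ n)
  set q : ℕ → ℝ → ℝ := fun n t => hamiltonianRemainder f L (u t) (z t) (ξ t) (δ n t) with hq
  have hineq : ∀ n, c ≤ (∫ t in Icc 0 T, ‖q n t‖ / β n) + Ξ * (2 * K) * (C * β n) := by
    intro n
    have h1 := hmin _ _ (hδp n) (by simp [hδ0])
    have h2 := hp.cost_sub_le hf hL.continuous hφ hr hK hξ hΞ hξeq (hB (n + n₀)).2.1
      (hB (n + n₀)).1 hv (hδ n) (hCβ n) (hδle n) (hδeq n) (hδp n) (hB (n + n₀)).2.2.2.2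
    have h3 : (c - Ξ * (2 * K) * (C * β n)) * β n ≤ ∫ t in Icc 0 T, ‖q n t‖ := by
      linarith
    have h4 := (le_div_iff₀ (hβpos n)).2 h3
    rw [integral_div]
    linarith
  have hlim : Tendsto (fun n => ∫ t in Icc 0 T, ‖q n t‖ / β n) atTop (𝓝 0) := by
    suffices h : Tendsto (fun n => ∫ t in Icc 0 T, ‖q n t‖ / β n) atTop
        (𝓝 (∫ _ in Icc 0 T, (0 : ℝ))) by simpa using h
    refine tendsto_integral_of_dominated_convergence (fun _ => (1 + Ξ) * (2 * K) * C)
      (fun n => ?_) (integrable_const _) (fun n => ?_) ?_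
    · simp only [div_eq_mul_inv]
      exact (hp.aestronglyMeasurable_hamiltonianRemainder hf hL.continuous hξ
        (hδ n)).norm.mul_const _
    · filter_upwards [hp.mem, ae_restrict_mem measurableSet_Icc] with t ht hmem
      have hΞt := hΞ t hmem
      have hδt := hδle n t hmem
      rw [norm_div, norm_norm, Real.norm_of_nonneg (hβpos n).le, div_le_iff₀ (hβpos n)]
      refine (hK.norm_hamiltonianRemainder_le ht (hr t hmem) (hδt.trans (hCβ n)) _).trans ?_
      calc _ ≤ (1 + Ξ) * (2 * K) * (C * β n) := by gcongr
        _ = _ := by ring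
    · filter_upwards [ae_restrict_mem measurableSet_Icc] with t hmem
      have hO : (fun n => δ n t) =O[atTop] β := Asymptotics.IsBigO.of_bound C
        (Eventually.of_forall fun n => by
          rw [Real.norm_of_nonneg (hβpos n).le]
          exact hδle n t hmem)
      have hδt : Tendsto (fun n => δ n t) atTop (𝓝 0) := hO.trans_tendsto hβ0
      -- For fixed t, differentiability gives q = o(δ), and δ = O(β).
      have ho : (fun n => q n t) =o[atTop] β :=
        ((hamiltonianRemainder_isLittleO (ξ t) (hf' (u t) (z t)) (hL (z t))).comp_tendsto
          hδt).trans_isBigO hO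
      exact ho.norm_left.tendsto_div_nhds_zero
  have hlim2 : Tendsto (fun n => (∫ t in Icc 0 T, ‖q n t‖ / β n) + Ξ * (2 * K) * (C * β n))
      atTop (𝓝 0) := by
    have := hlim.add ((hβ0.const_mul C).const_mul (Ξ * (2 * K)))
    simpa using this
  exact hc.not_ge (ge_of_tendsto' hlim2 hineq)

/-- Pontryagin's principle for minimizing `∫ (L z + φ u)` over the trajectories of `ż = f u z` with
given initial value, free final value, and controls in a compact set. -/
theorem IsControlProcess.exists_adjoint (hT : 0 ≤ T)
    (hp : IsControlProcess T f U z u) (hU : IsCompact U)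
    (hf : LocallyLipschitz (Function.uncurry f)) (hf' : ∀ v, Differentiable ℝ (f v))
    (hL : LocallyLipschitz L) (hL' : Differentiable ℝ L) (hφ : Continuous φ)
    (hmin : ∀ z' u', IsControlProcess T f U z' u' → z' 0 = z 0 →
      ∫ t in Icc 0 T, (L (z t) + φ (u t)) ≤ ∫ t in Icc 0 T, (L (z' t) + φ (u' t))) :
    ∃ ξ : ℝ → E →L[ℝ] ℝ, Continuous ξ ∧
      MemLp (fun t => adjointField f L (u t) (z t) (ξ t)) 2 (volume.restrict (Icc 0 T)) ∧
      (∀ t ∈ Icc 0 T, ξ t = ∫ s in t..T, adjointField f L (u s) (z s) (ξ s)) ∧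
      ∀ᵐ t ∂(volume.restrict (Icc 0 T)), ∀ v ∈ U,
        φ (u t) + ξ t (f (u t) (z t)) ≤ φ v + ξ t (f v (z t)) := by
  obtain ⟨r, hr⟩ := isCompact_Icc.exists_bound_of_continuousOn hp.continuousOn
  obtain ⟨K, hK⟩ := exists_hasBoundsOnBall hU hf hL hφ (r + 1)
  obtain ⟨ξ, hξ, hξeq⟩ := exists_adjoint_solution hT hK.pos
    (hp.aestronglyMeasurable_fderiv_dyn hf.continuous) (hp.aestronglyMeasurable_fderiv_cost L)
    (by
      filter_upwards [hp.mem, ae_restrict_mem measurableSet_Icc] with t ht hmem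
      exact hK.norm_fderiv_dyn_le ht (hr t hmem))
    (by
      filter_upwards [ae_restrict_mem measurableSet_Icc] with t hmem
      exact hK.norm_fderiv_cost_le (hr t hmem))
  obtain ⟨Ξ, hΞ⟩ := isCompact_Icc.exists_bound_of_continuousOn (hξ.continuousOn (s := Icc 0 T))
  refine ⟨ξ, hξ, MemLp.of_bound (hp.aestronglyMeasurable_adjointField hf.continuous hξ) _
    (hp.ae_norm_adjointField_le hr hK hΞ), hξeq, ?_⟩
  -- The exceptional null set depends on v. A countable dense subset of U allows a common one, and
  -- continuity in v extends the inequality to U.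
  obtain ⟨S, hSU, hS, hUS⟩ := EMetric.subset_countable_closure_of_compact hU
  have hae : ∀ᵐ t ∂(volume.restrict (Icc 0 T)), ∀ v ∈ S,
      0 ≤ hamiltonianIncrement f φ v (u t) (z t) (ξ t) :=
    (ae_ball_iff hS).2 fun v hv => hp.ae_hamiltonianIncrement_nonneg hT hf.continuous hf' hL' hφ
      hr hK hξ hξeq hmin (hSU hv)
  filter_upwards [hae] with t ht v hv
  have hcf : Continuous fun v => f v (z t) :=
    hf.continuous.comp (continuous_id.prodMk continuous_const)
  have hclosed : IsClosed {v | 0 ≤ hamiltonianIncrement f φ v (u t) (z t) (ξ t)} := by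
    refine isClosed_le continuous_const ?_
    unfold hamiltonianIncrement
    fun_prop
  have hmem : 0 ≤ hamiltonianIncrement f φ v (u t) (z t) (ξ t) :=
    closure_minimal (fun v hv => ht v hv) hclosed (hUS hv)
  rw [hamiltonianIncrement, map_sub] at hmem
  linarith

end MaximumPrinciple

/-! ### Operations preserving local Lipschitz continuity. -/

section LocallyLipschitz

variable {A B : Type*} [PseudoEMetricSpace A] [NormedAddCommGroup B]

theorem LocallyLipschitz.fun_add {f g : A → B} (hf : LocallyLipschitz f)
    (hg : LocallyLipschitz g) : LocallyLipschitz fun a => f a + g a := fun a => by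
  obtain ⟨K₁, s, hs, h₁⟩ := hf a
  obtain ⟨K₂, t, ht, h₂⟩ := hg a
  exact ⟨_, _, inter_mem hs ht, (h₁.mono inter_subset_left).add (h₂.mono inter_subset_right)⟩

theorem LocallyLipschitz.fun_sum {ι : Type*} (s : Finset ι) {f : ι → A → B}
    (hf : ∀ i, LocallyLipschitz (f i)) : LocallyLipschitz fun a => ∑ i ∈ s, f i a := by
  classical
  induction s using Finset.induction_on with
  | empty => simpa using LocallyLipschitz.const (0 : B)
  | insert i s his ih => simpa [Finset.sum_insert his] using (hf i).fun_add ih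

variable [NormedSpace ℝ B]

theorem LocallyLipschitz.fun_const_smul (c : ℝ) {f : A → B} (hf : LocallyLipschitz f) :
    LocallyLipschitz fun a => c • f a :=
  (lipschitzWith_smul c).locallyLipschitz.comp hf

theorem LocallyLipschitz.fun_smul {c : A → ℝ} {f : A → B} (hc : LocallyLipschitz c)
    (hf : LocallyLipschitz f) : LocallyLipschitz fun a => c a • f a :=
  (ContDiff.locallyLipschitz (𝕂 := ℝ) (f := fun p : ℝ × B => p.1 • p.2) (by fun_prop)).comp
    (hc.prodMk hf)

theorem LocallyLipschitz.pi {ι : Type*} [Fintype ι] {C : ι → Type*}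
    [∀ i, PseudoEMetricSpace (C i)] {f : ∀ i, A → C i} (hf : ∀ i, LocallyLipschitz (f i)) :
    LocallyLipschitz fun a i => f i a := fun a => by
  choose K s hs h using fun i => hf i a
  refine ⟨∑ i, K i, ⋂ i, s i, iInter_mem.2 hs, fun x hx y hy => edist_pi_le_iff.2 fun i => ?_⟩
  refine (h i (mem_iInter.1 hx i) (mem_iInter.1 hy i)).trans ?_
  gcongr
  exact Finset.single_le_sum (f := K) (fun _ _ => bot_le) (Finset.mem_univ i)

end LocallyLipschitz

namespace LeaderFollower

/-! ### Calculus of weak derivatives. -/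

section WeakDerivative

variable {E F : Type*} [NormedAddCommGroup E] [NormedSpace ℝ E] [NormedAddCommGroup F]
  [NormedSpace ℝ F] {T : ℝ} {x v : ℝ → E}

theorem HasWeakDerivOn.integrableOn (h : HasWeakDerivOn T x v) : IntegrableOn v (Icc 0 T) :=
  h.1.integrable one_le_two

theorem HasWeakDerivOn.continuousOn (h : HasWeakDerivOn T x v) : ContinuousOn x (Icc 0 T) := by
  rcases le_or_gt 0 T with hT | hT
  · have := intervalIntegral.continuousOn_primitive_interval (μ := volume)
      (f := v) (a := 0) (b := T) (by rw [uIcc_of_le hT]; exact h.integrableOn)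
    rw [uIcc_of_le hT] at this
    exact (continuousOn_const.add this).congr h.2
  · simp [Icc_eq_empty hT.not_ge]

theorem HasWeakDerivOn.memLp (h : HasWeakDerivOn T x v) :
    MemLp x 2 (volume.restrict (Icc 0 T)) := by
  obtain ⟨C, hC⟩ := isCompact_Icc.exists_bound_of_continuousOn h.continuousOn
  exact MemLp.of_bound (h.continuousOn.aestronglyMeasurable_of_isCompact isCompact_Icc
    measurableSet_Icc) C ((ae_restrict_mem measurableSet_Icc).mono hC)

theorem HasWeakDerivOn.clm_comp [CompleteSpace E] [CompleteSpace F] (h : HasWeakDerivOn T x v)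
    (A : E →L[ℝ] F) : HasWeakDerivOn T (fun t => A (x t)) (fun t => A (v t)) := by
  refine ⟨A.comp_memLp' h.1, fun t ht => ?_⟩
  beta_reduce
  rw [A.intervalIntegral_comp_comm (h.integrableOn.intervalIntegrable_of_mem_Icc
    ⟨le_rfl, ht.1.trans ht.2⟩ ht), h.2 t ht, map_add]

theorem HasWeakDerivOn.fun_add {y w : ℝ → E} (h : HasWeakDerivOn T x v)
    (h' : HasWeakDerivOn T y w) :
    HasWeakDerivOn T (fun t => x t + y t) (fun t => v t + w t) := by
  refine ⟨h.1.add h'.1, fun t ht => ?_⟩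
  beta_reduce
  have h0 : (0 : ℝ) ∈ Icc 0 T := ⟨le_rfl, ht.1.trans ht.2⟩
  rw [intervalIntegral.integral_add (h.integrableOn.intervalIntegrable_of_mem_Icc h0 ht)
    (h'.integrableOn.intervalIntegrable_of_mem_Icc h0 ht), h.2 t ht, h'.2 t ht]
  abel

theorem HasWeakDerivOn.fun_sum {ι : Type*} (s : Finset ι) {x v : ι → ℝ → E}
    (h : ∀ i, HasWeakDerivOn T (x i) (v i)) :
    HasWeakDerivOn T (fun t => ∑ i ∈ s, x i t) (fun t => ∑ i ∈ s, v i t) := by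
  classical
  induction s using Finset.induction_on with
  | empty => exact ⟨by simp, by simp⟩
  | insert i s his ih => simpa [Finset.sum_insert his] using (h i).fun_add ih

theorem HasWeakDerivOn.pi {ι : Type*} [Fintype ι] [CompleteSpace E] {x v : ℝ → ι → E}
    (h : ∀ i, HasWeakDerivOn T (fun t => x t i) (fun t => v t i)) : HasWeakDerivOn T x v := by
  classical
  have := HasWeakDerivOn.fun_sum Finset.univ fun i =>
    (h i).clm_comp (ContinuousLinearMap.single ℝ (fun _ : ι => E) i)
  simpa [Finset.univ_sum_single] using this

theorem HasWeakDerivOn.prodMk [CompleteSpace E] [CompleteSpace F] {y w : ℝ → F}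
    (h : HasWeakDerivOn T x v) (h' : HasWeakDerivOn T y w) :
    HasWeakDerivOn T (fun t => (x t, y t)) (fun t => (v t, w t)) := by
  have := (h.clm_comp (ContinuousLinearMap.inl ℝ E F)).fun_add
    (h'.clm_comp (ContinuousLinearMap.inr ℝ E F))
  simpa using this

/-- A curve given by a backward integral with square integrable integrand. -/
theorem hasWeakDerivOn_of_eq_integral_to_end (hv : MemLp v 2 (volume.restrict (Icc 0 T)))
    (hx : ∀ t ∈ Icc 0 T, x t = ∫ s in t..T, v s) : HasWeakDerivOn T x (fun t => -v t) := by
  refine ⟨hv.neg, fun t ht => ?_⟩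
  have hi : IntegrableOn v (Icc 0 T) := hv.integrable one_le_two
  have h0 : (0 : ℝ) ∈ Icc 0 T := ⟨le_rfl, ht.1.trans ht.2⟩
  have hT : T ∈ Icc 0 T := ⟨ht.1.trans ht.2, le_rfl⟩
  rw [hx t ht, hx 0 h0, intervalIntegral.integral_neg,
    ← intervalIntegral.integral_add_adjacent_intervals (hi.intervalIntegrable_of_mem_Icc h0 ht)
      (hi.intervalIntegrable_of_mem_Icc ht hT)]
  abel

end WeakDerivative

/-! ### The leader-follower system as a control process. -/

namespace Problem

variable {d m N : ℕ} (P : Problem d m N)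

/-- The joint dynamics of leaders and followers. -/
def dynamics (u : Ctrl d m) (z : (Fin m → Pt d) × (Fin N → Pt d)) :
    (Fin m → Pt d) × (Fin N → Pt d) :=
  (fun k => u k, fun i => P.velocity z.1 z.2 u i)

variable {P}

theorem locallyLipschitz_velocity (hH : IsKernel P.H) (hG : ∀ ℓ, IsKernel (P.G ℓ)) (i : Fin N) :
    LocallyLipschitz fun p : Ctrl d m × ((Fin m → Pt d) × (Fin N → Pt d)) =>
      P.velocity p.2.1 p.2.2 p.1 i := by
  refine .fun_add (.fun_const_smul _ (.fun_sum _ fun j => ?_))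
    (.fun_sum _ fun ℓ => .fun_const_smul _ (.fun_sum _ fun k => .fun_smul ?_ ?_))
  · exact hH.locallyLipschitz.comp (ContDiff.locallyLipschitz (𝕂 := ℝ) (by fun_prop))
  · exact ContDiff.locallyLipschitz (𝕂 := ℝ) (by fun_prop)
  · exact (hG ℓ).locallyLipschitz.comp (ContDiff.locallyLipschitz (𝕂 := ℝ) (by fun_prop))

theorem locallyLipschitz_dynamics (hH : IsKernel P.H) (hG : ∀ ℓ, IsKernel (P.G ℓ)) :
    LocallyLipschitz (Function.uncurry P.dynamics) :=
  .prodMk (.pi fun k => ContDiff.locallyLipschitz (𝕂 := ℝ) (by fun_prop))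
    (.pi fun i => locallyLipschitz_velocity hH hG i)

theorem differentiable_velocity (hH : IsKernel P.H) (hG : ∀ ℓ, IsKernel (P.G ℓ)) (u : Ctrl d m)
    (i : Fin N) : Differentiable ℝ fun z : (Fin m → Pt d) × (Fin N → Pt d) =>
      P.velocity z.1 z.2 u i := by
  have h1 := hH.differentiable
  have h2 := fun ℓ => (hG ℓ).differentiable
  unfold velocity
  fun_prop

theorem differentiable_dynamics (hH : IsKernel P.H) (hG : ∀ ℓ, IsKernel (P.G ℓ)) (u : Ctrl d m) :
    Differentiable ℝ (P.dynamics u) :=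
  (differentiable_const _).prodMk
    (differentiable_pi.2 fun i => differentiable_velocity hH hG u i)

variable {Y : ℝ → Fin m → Pt d} {X : ℝ → Fin N → Pt d} {u : ℝ → Ctrl d m}

theorem StateEq.isControlProcess (hu : P.IsControl u) (h : P.StateEq Y X u) :
    IsControlProcess P.T P.dynamics P.U (fun t => (Y t, X t)) u := by
  have := (HasWeakDerivOn.pi h.leaders).prodMk (HasWeakDerivOn.pi h.followers)
  exact ⟨hu.1, hu.2, this.continuousOn, this.2⟩

/-- Every competitor in the abstract problem must be admissible in the original one. Square
integrability of the velocity is automatic: the trajectory is bounded and U is compact. -/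
theorem stateEq_of_isControlProcess (hH : IsKernel P.H) (hG : ∀ ℓ, IsKernel (P.G ℓ))
    (hU : IsCompact P.U) {z : ℝ → (Fin m → Pt d) × (Fin N → Pt d)}
    (h : IsControlProcess P.T P.dynamics P.U z u) (h0 : z 0 = (P.Y₀, P.X₀)) :
    P.StateEq (fun t => (z t).1) (fun t => (z t).2) u := by
  have hf := locallyLipschitz_dynamics hH hG
  obtain ⟨r, hr⟩ := isCompact_Icc.exists_bound_of_continuousOn h.continuousOn
  obtain ⟨K, hK⟩ := exists_hasBoundsOnBall (L := fun _ => 0) (φ := fun _ => 0) hU hf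
    (LocallyLipschitz.const 0) continuous_const r
  have hmeas := h.aestronglyMeasurable_dyn hf.continuous h.aestronglyMeasurable
    (continuous_const (y := 0))
  simp only [add_zero] at hmeas
  have hw : HasWeakDerivOn P.T z (fun t => P.dynamics (u t) (z t)) := by
    refine ⟨MemLp.of_bound hmeas K ?_, h.eq_integral⟩
    filter_upwards [h.mem, ae_restrict_mem measurableSet_Icc] with t ht hmem
    exact hK.bound_dyn _ ht _ (hr t hmem)
  refine ⟨fun k => ?_, fun i => ?_, by simp [h0], by simp [h0]⟩
  · exact hw.clm_comp ((ContinuousLinearMap.proj k).comp (ContinuousLinearMap.fst ℝ _ _))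
  · exact hw.clm_comp ((ContinuousLinearMap.proj i).comp (ContinuousLinearMap.snd ℝ _ _))

theorem cost_eq_setIntegral (hT : 0 ≤ P.T) :
    P.cost Y X u = ∫ t in Icc 0 P.T, (P.L (Y t, X t) + ∑ k, ‖u t k‖ ^ 2) := by
  rw [cost, intervalIntegral.integral_of_le hT, integral_Icc_eq_integral_Ioc]

theorem IsOptimal.exists_adjoint (hT : 0 ≤ P.T) (hH : IsKernel P.H) (hG : ∀ ℓ, IsKernel (P.G ℓ))
    (hL : LocallyLipschitz P.L) (hL' : Differentiable ℝ P.L) (hU : IsCompact P.U)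
    (hopt : P.IsOptimal Y X u) :
    ∃ ξ : ℝ → (Fin m → Pt d) × (Fin N → Pt d) →L[ℝ] ℝ, ξ P.T = 0 ∧
      HasWeakDerivOn P.T ξ (fun t => -adjointField P.dynamics P.L (u t) (Y t, X t) (ξ t)) ∧
      ∀ᵐ t ∂(volume.restrict (Icc 0 P.T)), ∀ v ∈ P.U,
        ∑ k, ‖u t k‖ ^ 2 + ξ t (P.dynamics (u t) (Y t, X t))
          ≤ ∑ k, ‖v k‖ ^ 2 + ξ t (P.dynamics v (Y t, X t)) := by
  obtain ⟨ξ, -, hmem, hξeq, hle⟩ := (hopt.state.isControlProcess hopt.control).exists_adjoint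
    (φ := fun v => ∑ k, ‖v k‖ ^ 2) hT hU (locallyLipschitz_dynamics hH hG)
    (differentiable_dynamics hH hG) hL hL' (by fun_prop) (fun z' u' hp h0 => by
      have h1 := hopt.minimal _ _ _ ⟨hp.aestronglyMeasurable, hp.mem⟩
        (stateEq_of_isControlProcess hH hG hU hp (by
          rw [h0, hopt.state.init_leaders, hopt.state.init_followers]))
      rwa [cost_eq_setIntegral hT, cost_eq_setIntegral hT] at h1)
  refine ⟨ξ, ?_, hasWeakDerivOn_of_eq_integral_to_end hmem hξeq, hle⟩
  rw [hξeq P.T ⟨hT, le_rfl⟩, intervalIntegral.integral_same]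

end Problem

end LeaderFollower

/-! ### Adjoint functionals in coordinates. -/

namespace LeaderFollower

theorem hasFDerivAt_update_single {ι F : Type*} [Fintype ι] [DecidableEq ι]
    [NormedAddCommGroup F] [NormedSpace ℝ F] (y : ι → F) (k : ι) (x : F) :
    HasFDerivAt (Function.update y k) (ContinuousLinearMap.single ℝ (fun _ : ι => F) k) x := by
  convert! hasFDerivAt_update (𝕜 := ℝ) y (i := k) x using 1
  ext z j
  by_cases h : j = k
  · subst h
    simp
  · simp [h]

section Insertion

variable {ι κ F : Type*} [Fintype ι] [Fintype κ] [NormedAddCommGroup F] [NormedSpace ℝ F]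
  [DecidableEq ι]

variable (F) in
/-- Insertion of the `k`-th coordinate of the first factor. -/
def inlSingle (κ : Type*) [Fintype κ] (k : ι) : F →L[ℝ] (ι → F) × (κ → F) :=
  (ContinuousLinearMap.inl ℝ _ _).comp (ContinuousLinearMap.single ℝ (fun _ : ι => F) k)

variable (F) in
/-- Insertion of the `i`-th coordinate of the second factor. -/
def inrSingle (κ : Type*) [Fintype κ] (k : ι) : F →L[ℝ] (κ → F) × (ι → F) :=
  (ContinuousLinearMap.inr ℝ _ _).comp (ContinuousLinearMap.single ℝ (fun _ : ι => F) k)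

theorem hasFDerivAt_update_fst (y : ι → F) (x : κ → F) (k : ι) (a : F) :
    HasFDerivAt (fun a => (Function.update y k a, x)) (inlSingle F κ k) a := by
  convert! (hasFDerivAt_update_single y k a).prodMk (hasFDerivAt_const x a) using 1

theorem hasFDerivAt_update_snd (y : κ → F) (x : ι → F) (k : ι) (a : F) :
    HasFDerivAt (fun a => (y, Function.update x k a)) (inrSingle F κ k) a := by
  convert! (hasFDerivAt_const y a).prodMk (hasFDerivAt_update_single x k a) using 1

end Insertion

variable {ι κ F : Type*} [Fintype ι] [Fintype κ] [NormedAddCommGroup F] [InnerProductSpace ℝ F]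
  [FiniteDimensional ℝ F]

/-- The Riesz representation as a continuous linear map. -/
def dualVector (F : Type*) [NormedAddCommGroup F] [InnerProductSpace ℝ F]
    [FiniteDimensional ℝ F] : (F →L[ℝ] ℝ) →L[ℝ] F :=
  have := FiniteDimensional.complete ℝ F
  LinearMap.toContinuousLinearMap
    { toFun := fun g => (InnerProductSpace.toDual ℝ F).symm g
      map_add' := fun g h => map_add _ g h
      map_smul' := fun c g => by simp }

theorem inner_dualVector (g : F →L[ℝ] ℝ) (x : F) : inner ℝ (dualVector F g) x = g x := by
  have := FiniteDimensional.complete ℝ F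
  exact InnerProductSpace.toDual_symm_apply

/-- The vector representing the restriction of a functional along a linear map. -/
def component {E : Type*} [NormedAddCommGroup E] [NormedSpace ℝ E] (J : F →L[ℝ] E) :
    (E →L[ℝ] ℝ) →L[ℝ] F :=
  (dualVector F).comp ((ContinuousLinearMap.compL ℝ F E ℝ).flip J)

theorem inner_component {E : Type*} [NormedAddCommGroup E] [NormedSpace ℝ E] (J : F →L[ℝ] E)
    (ξ : E →L[ℝ] ℝ) (x : F) : inner ℝ (component J ξ) x = ξ (J x) := by
  simp [component, inner_dualVector]

/-- The chain rule along γ. With γ varying one particle only, a component of the full derivative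
becomes a partial gradient. -/
theorem component_fderiv [CompleteSpace F] {E : Type*} [NormedAddCommGroup E] [NormedSpace ℝ E]
    {J : F →L[ℝ] E} {g : E → ℝ} {γ : F → E} {x : F} (hg : DifferentiableAt ℝ g (γ x))
    (hγ : HasFDerivAt γ J x) :
    component J (fderiv ℝ g (γ x)) = gradient (fun x => g (γ x)) x := by
  refine ext_inner_right ℝ fun y => ?_
  have h : HasFDerivAt (fun x => g (γ x)) ((fderiv ℝ g (γ x)).comp J) x :=
    hg.hasFDerivAt.comp x hγ
  rw [inner_component, gradient, InnerProductSpace.toDual_symm_apply, h.fderiv]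
  rfl

variable [DecidableEq ι]

/-- Every functional on the product is the sum of its components. -/
theorem apply_eq_sum_inner [DecidableEq κ] (ξ : (ι → F) × (κ → F) →L[ℝ] ℝ)
    (w : (ι → F) × (κ → F)) :
    ξ w = ∑ k, inner ℝ (component (inlSingle F κ k) ξ) (w.1 k)
      + ∑ i, inner ℝ (component (inrSingle F ι i) ξ) (w.2 i) := by
  simp only [inner_component, ← map_sum, ← map_add]
  congr 1
  ext j <;> simp [inlSingle, inrSingle, Prod.fst_sum, Prod.snd_sum, Finset.sum_pi_single]

/-! ### The adjoint system and the projection formula. -/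

namespace Problem

variable {d m N : ℕ} {P : Problem d m N}

/-- The component of a functional belonging to the `k`-th leader. -/
def leaderComponent (k : Fin m) :
    ((Fin m → Pt d) × (Fin N → Pt d) →L[ℝ] ℝ) →L[ℝ] Pt d :=
  component (inlSingle (Pt d) (Fin N) k)

/-- The component of a functional belonging to the `i`-th follower. -/
def followerComponent (i : Fin N) :
    ((Fin m → Pt d) × (Fin N → Pt d) →L[ℝ] ℝ) →L[ℝ] Pt d :=
  component (inrSingle (Pt d) (Fin m) i)

/-- The leaders' velocities do not depend on the state, so that block of the derivative vanishes and
only the follower components of ξ remain. A general γ covers variations of leaders and followers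
alike. -/
theorem component_comp_fderiv_dynamics (hH : IsKernel P.H) (hG : ∀ ℓ, IsKernel (P.G ℓ))
    (u : Ctrl d m) (ξ : (Fin m → Pt d) × (Fin N → Pt d) →L[ℝ] ℝ)
    {J : Pt d →L[ℝ] (Fin m → Pt d) × (Fin N → Pt d)}
    {γ : Pt d → (Fin m → Pt d) × (Fin N → Pt d)} {x : Pt d} (hγ : HasFDerivAt γ J x) :
    component J (ξ.comp (fderiv ℝ (P.dynamics u) (γ x)))
      = ∑ j, ContinuousLinearMap.adjoint
        (fderiv ℝ (fun a => P.velocity (γ a).1 (γ a).2 u j) x) (followerComponent j ξ) := by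
  refine ext_inner_right ℝ fun y => ?_
  have hv : ∀ j, HasFDerivAt (fun a => P.velocity (γ a).1 (γ a).2 u j)
      ((fderiv ℝ (fun z : (Fin m → Pt d) × (Fin N → Pt d) => P.velocity z.1 z.2 u j) (γ x)).comp J)
      x := fun j =>
    (differentiable_velocity hH hG u j (γ x)).hasFDerivAt.comp (f := γ) x hγ
  have hD : HasFDerivAt (P.dynamics u) (ContinuousLinearMap.prod 0 (ContinuousLinearMap.pi fun j =>
      fderiv ℝ (fun z : (Fin m → Pt d) × (Fin N → Pt d) => P.velocity z.1 z.2 u j) (γ x))) (γ x) :=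
    (hasFDerivAt_const _ _).prodMk (hasFDerivAt_pi.2 fun j =>
      (differentiable_velocity hH hG u j (γ x)).hasFDerivAt)
  rw [inner_component, hD.fderiv, ContinuousLinearMap.comp_apply, apply_eq_sum_inner, sum_inner]
  simp only [ContinuousLinearMap.adjoint_inner_left, (hv _).fderiv]
  simp [followerComponent]

theorem leaderComponent_adjointField (hH : IsKernel P.H) (hG : ∀ ℓ, IsKernel (P.G ℓ))
    (hL' : Differentiable ℝ P.L) (y : Fin m → Pt d) (x : Fin N → Pt d)
    (u : Ctrl d m) (ξ : (Fin m → Pt d) × (Fin N → Pt d) →L[ℝ] ℝ) (k : Fin m) :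
    leaderComponent k (adjointField P.dynamics P.L u (y, x) ξ)
      = P.gradY y x k + P.adjY y x u (fun i => followerComponent i ξ) k := by
  have hγ := hasFDerivAt_update_fst y x k (y k)
  have h1 := component_fderiv (hL' _) hγ
  have h2 := component_comp_fderiv_dynamics hH hG u ξ hγ
  simp only [Function.update_eq_self] at h1 h2
  rw [adjointField, map_add, leaderComponent, h1, h2]
  rfl

theorem followerComponent_adjointField (hH : IsKernel P.H) (hG : ∀ ℓ, IsKernel (P.G ℓ))
    (hL' : Differentiable ℝ P.L) (y : Fin m → Pt d) (x : Fin N → Pt d)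
    (u : Ctrl d m) (ξ : (Fin m → Pt d) × (Fin N → Pt d) →L[ℝ] ℝ) (i : Fin N) :
    followerComponent i (adjointField P.dynamics P.L u (y, x) ξ)
      = P.gradX y x i + P.adjX y x u (fun i => followerComponent i ξ) i := by
  have hγ := hasFDerivAt_update_snd y x i (x i)
  have h1 := component_fderiv (hL' _) hγ
  have h2 := component_comp_fderiv_dynamics hH hG u ξ hγ
  simp only [Function.update_eq_self] at h1 h2
  rw [adjointField, map_add, followerComponent, h1, h2]
  rfl

/-- Completing the square: up to a constant, the Hamiltonian is `‖v‖² - 2 ⟪p, v⟫`, with `p` the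
feedback. -/
theorem sum_sq_add_apply_dynamics (y : Fin m → Pt d) (x : Fin N → Pt d)
    (ξ : (Fin m → Pt d) × (Fin N → Pt d) →L[ℝ] ℝ) (v : Ctrl d m) :
    ∑ k, ‖v k‖ ^ 2 + ξ (P.dynamics v (y, x))
      = ‖v‖ ^ 2 - 2 * inner ℝ (P.feedback y x (fun k => leaderComponent k ξ)
          (fun i => followerComponent i ξ)) v
        + ∑ i, inner ℝ (followerComponent i ξ) ((1 / (N : ℝ)) • ∑ j, P.H (x i - x j)) := by
  rw [PiLp.norm_sq_eq_of_L2, apply_eq_sum_inner]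
  have h1 : inner ℝ (P.feedback y x (fun k => leaderComponent k ξ)
      (fun i => followerComponent i ξ)) v
      = ∑ k, ∑ ℓ, -(1 / 2) * ((1 / (m : ℝ)) * ∑ i, inner ℝ (followerComponent i ξ)
        (P.G ℓ (x i - y k)) + leaderComponent k ξ ℓ) * v k ℓ := by
    simp only [PiLp.inner_apply, feedback]
    refine Finset.sum_congr rfl fun k _ => Finset.sum_congr rfl fun ℓ _ => ?_
    simp [mul_comm]
  have h2 : ∀ k, inner ℝ (leaderComponent k ξ) (v k) = ∑ ℓ, leaderComponent k ξ ℓ * v k ℓ := by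
    intro k
    simp [PiLp.inner_apply, mul_comm]
  have h3 : ∑ i, inner ℝ (followerComponent i ξ)
        (∑ ℓ, (1 / (m : ℝ)) • ∑ k, v k ℓ • P.G ℓ (x i - y k))
      = ∑ k, ∑ ℓ, (1 / (m : ℝ)) * (∑ i, inner ℝ (followerComponent i ξ)
        (P.G ℓ (x i - y k))) * v k ℓ := by
    simp only [inner_sum, inner_smul_right, Finset.mul_sum, Finset.sum_mul]
    rw [Finset.sum_comm, Finset.sum_comm (γ := Fin m)]
    refine Finset.sum_congr rfl fun ℓ _ => ?_
    rw [Finset.sum_comm]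
    refine Finset.sum_congr rfl fun k _ => Finset.sum_congr rfl fun i _ => ?_
    ring
  -- This identity explains the formula for p: -2⟨p, v⟩ is exactly the part of ξ(f) linear in v. The
  -- H term does not involve v.
  have h4 : -2 * inner ℝ (P.feedback y x (fun k => leaderComponent k ξ)
      (fun i => followerComponent i ξ)) v
      = (∑ k, inner ℝ (leaderComponent k ξ) (v k)) + ∑ i, inner ℝ (followerComponent i ξ)
        (∑ ℓ, (1 / (m : ℝ)) • ∑ k, v k ℓ • P.G ℓ (x i - y k)) := by
    rw [h1, h3]
    simp only [h2]
    rw [← Finset.sum_add_distrib, Finset.mul_sum]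
    refine Finset.sum_congr rfl fun k _ => ?_
    rw [← Finset.sum_add_distrib, Finset.mul_sum]
    refine Finset.sum_congr rfl fun ℓ _ => ?_
    ring
  simp only [dynamics, velocity, inner_add_right, Finset.sum_add_distrib]
  simp only [leaderComponent, followerComponent] at h4 ⊢
  linarith

/-- Adding ‖p‖² turns both sides into squared distances to p. Convexity plays no role, so the
nearest point need not be unique. -/
theorem isProj_of_forall_le {V : Type*} [NormedAddCommGroup V] [InnerProductSpace ℝ V] {U : Set V}
    {p u : V} (hu : u ∈ U)
    (h : ∀ v ∈ U, ‖u‖ ^ 2 - 2 * inner ℝ p u ≤ ‖v‖ ^ 2 - 2 * inner ℝ p v) : IsProj U p u := by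
  refine ⟨hu, le_antisymm ((Metric.le_infDist ⟨u, hu⟩).2 fun v hv => ?_)
    (Metric.infDist_le_dist_of_mem hu)⟩
  rw [dist_eq_norm, dist_eq_norm]
  refine le_of_sq_le_sq ?_ (norm_nonneg _)
  rw [norm_sub_sq_real, norm_sub_sq_real]
  linarith [h v hv]

theorem gradY_of_trackingCost {Xs : Pt d} (hP : P.L = trackingCost Xs) (y : Fin m → Pt d)
    (x : Fin N → Pt d) (k : Fin m) : P.gradY y x k = 0 := by
  simp only [gradY, hP, trackingCost]
  exact gradient_const _ _

theorem gradX_of_trackingCost {Xs : Pt d} (hP : P.L = trackingCost Xs) (y : Fin m → Pt d)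
    (x : Fin N → Pt d) (i : Fin N) : P.gradX y x i = x i - Xs := by
  -- Only the i-th summand depends on the varied position; the others form an additive constant.
  have h1 : (fun a => P.L (y, Function.update x i a))
      = fun a => (1 / 2) * (‖a - Xs‖ ^ 2 + ∑ j ∈ Finset.univ.erase i, ‖x j - Xs‖ ^ 2) := by
    ext a
    rw [hP, trackingCost, ← Finset.add_sum_erase _ _ (Finset.mem_univ i)]
    simp only [Function.update_self]
    congr 2
    refine Finset.sum_congr rfl fun j hj => ?_
    rw [Function.update_of_ne (Finset.ne_of_mem_erase hj)]
  rw [gradX, h1]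
  refine HasGradientAt.gradient (hasGradientAt_iff_hasFDerivAt.2 ?_)
  have h2 := ((((hasFDerivAt_id (𝕜 := ℝ) (x i)).sub_const Xs).norm_sq).add_const
    (∑ j ∈ Finset.univ.erase i, ‖x j - Xs‖ ^ 2)).const_mul (1 / 2)
  convert! h2 using 1
  ext a
  simp

/-- First order optimality conditions: adjoint system and projection formula. -/
theorem IsOptimal.exists_firstOrder (hT : 0 ≤ P.T) (hH : IsKernel P.H)
    (hG : ∀ ℓ, IsKernel (P.G ℓ)) (hL : LocallyLipschitz P.L) (hL' : Differentiable ℝ P.L)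
    (hU : IsCompact P.U) {Y : ℝ → Fin m → Pt d} {X : ℝ → Fin N → Pt d} {u : ℝ → Ctrl d m}
    (hopt : P.IsOptimal Y X u) :
    ∃ (ξY : ℝ → Fin m → Pt d) (ξX : ℝ → Fin N → Pt d), P.FirstOrder Y X u ξY ξX ∧
      ∀ Xs : Pt d, P.L = trackingCost Xs →
        (∀ k, HasWeakDerivOn P.T (fun t => ξY t k)
          (fun t => -P.adjY (Y t) (X t) (u t) (ξX t) k)) ∧
        (∀ i, HasWeakDerivOn P.T (fun t => ξX t i)
          (fun t => -((X t i - Xs) + P.adjX (Y t) (X t) (u t) (ξX t) i))) := by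
  obtain ⟨ξ, hξT, hw, hle⟩ := hopt.exists_adjoint hT hH hG hL hL' hU
  have hY : ∀ k, HasWeakDerivOn P.T (fun t => leaderComponent k (ξ t))
      (fun t => -(P.gradY (Y t) (X t) k
        + P.adjY (Y t) (X t) (u t) (fun i => followerComponent i (ξ t)) k)) := by
    intro k
    have := hw.clm_comp (leaderComponent k)
    simpa only [map_neg, leaderComponent_adjointField hH hG hL'] using this
  have hX : ∀ i, HasWeakDerivOn P.T (fun t => followerComponent i (ξ t))
      (fun t => -(P.gradX (Y t) (X t) i
        + P.adjX (Y t) (X t) (u t) (fun i => followerComponent i (ξ t)) i)) := by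
    intro i
    have := hw.clm_comp (followerComponent i)
    simpa only [map_neg, followerComponent_adjointField hH hG hL'] using this
  refine ⟨fun t k => leaderComponent k (ξ t), fun t i => followerComponent i (ξ t),
    ⟨(HasWeakDerivOn.pi hY).memLp, (HasWeakDerivOn.pi hX).memLp, ?_, hopt.state, hY, hX,
      ?_, ?_⟩,
    fun Xs hXs => ⟨fun k => ?_, fun i => ?_⟩⟩
  · filter_upwards [hle, hopt.control.2] with t ht hu
    refine isProj_of_forall_le hu fun v hv => ?_
    have := ht v hv
    rw [sum_sq_add_apply_dynamics, sum_sq_add_apply_dynamics] at this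
    linarith
  · ext1 k
    simp [hξT]
  · ext1 i
    simp [hξT]
  · simpa only [gradY_of_trackingCost hXs, zero_add] using hY k
  · simpa only [gradX_of_trackingCost hXs] using hX i


end Problem

end LeaderFollower

end

theorem mainTheorem6 {d m N : ℕ} (hd : 0 < d) (hm : 0 < m) (hN : 0 < N)
    (P : LeaderFollower.Problem d m N)
    (hT : 0 < P.T)
    (hH : LeaderFollower.IsKernel P.H)
    (hG : ∀ ℓ, LeaderFollower.IsKernel (P.G ℓ))
    (hL : LocallyLipschitz P.L) (hL' : Differentiable ℝ P.L)
    (hU : IsCompact P.U) (hU' : P.U.Nonempty)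
    (Y : ℝ → Fin m → LeaderFollower.Pt d) (X : ℝ → Fin N → LeaderFollower.Pt d)
    (u : ℝ → LeaderFollower.Ctrl d m)
    (hopt : P.IsOptimal Y X u) :
    ∃ (ξY : ℝ → Fin m → LeaderFollower.Pt d) (ξX : ℝ → Fin N → LeaderFollower.Pt d),
      P.FirstOrder Y X u ξY ξX ∧
      ∀ Xs : LeaderFollower.Pt d, P.L = LeaderFollower.trackingCost Xs →
        (∀ k, LeaderFollower.HasWeakDerivOn P.T (fun t => ξY t k)
          (fun t => -P.adjY (Y t) (X t) (u t) (ξX t) k)) ∧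
        (∀ i, LeaderFollower.HasWeakDerivOn P.T (fun t => ξX t i)
          (fun t => -((X t i - Xs) + P.adjX (Y t) (X t) (u t) (ξX t) i))) :=
  hopt.exists_firstOrder hT.le hH hG hL hL' hU
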